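/- Let $F$ be an algebraically closed field of characteristic different from $2$, and let $p,q\in F^\times$ not be roots of unity. For $n\ge 0$ let $\mathcal H_n$ be the affine Hecke algebra of type $B_n$: the associative unital $F$-algebra generated by $X_0^{\pm1},\dots,X_n^{\pm1},T_0,\dots,T_{n-1}$, where the $X_j^{\pm1}$ commute with each other, subject to $$(T_0-p)(T_0+p^{-1})=0,\qquad (T_i-q)(T_i+q^{-1})=0\ (i\ge1),$$ $$T_iT_{i+1}T_i=T_{i+1}T_iT_{i+1}\ (i\ge1),\qquad T_iT_j=T_jT_i\ (|i-j|>1),\qquad T_1T_0T_1T_0=T_0T_1T_0T_1,$$ $$T_0X_0T_0=X_0X_1,\qquad T_iX_j=X_jT_i\ (j\ne i,i+1),\qquad T_iX_iT_i=X_{i+1}\ (i\ge1)$$ (so $\mathcal H_0=F[X_0^{\pm1}]$). For $n\ge1$ let $\mathcal H_{n-1,1}\cong\mathcal H_{n-1}\otimes_F F[X_n^{\pm1}]$ be the subalgebra of $\mathcal H_n$ generated by $T_0,\dots,T_{n-2}$ and $X_0^{\pm1},\dots,X_n^{\pm1}$. For an $\mathcal H_{n-1}$-module $N$ and $a\in F^\times$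 let $N\boxtimes(a)$ be the $\mathcal H_{n-1,1}$-module on which $\mathcal H_{n-1}$ acts as on $N$ and $X_n$ acts as the scalar $a$, and set $$f_aN:=\operatorname{ind}_{n-1,1}^{n}N\boxtimes(a)=\mathcal H_n\otimes_{\mathcal H_{n-1,1}}(N\boxtimes(a)).$$ **Theorem.** Let $n\ge1$, let $N$ be a finite-dimensional irreducible (left) $\mathcal H_{n-1}$-module, let $a\in\{1,-1\}$, and put $M:=f_aN$. Then $\dim_F\operatorname{End}_{\mathcal H_n}(M)\le 2$. -/

import Mathlib

open scoped TensorProduct LaurentPolynomial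

noncomputable section

namespace HeckeB

/-- Symbols for the generators `T_0, …, T_{n-1}`, `X_0, …, X_n` and `X_0⁻¹, …, X_n⁻¹`. -/
inductive Gen (n : ℕ) : Type
  | T (i : Fin n)
  | X (j : Fin (n + 1))
  | Xinv (j : Fin (n + 1))

section Relations

variable (F : Type*) [Field F] (n : ℕ)

/-- The free generator `T_i`. -/
abbrev freeT (i : Fin n) : FreeAlgebra F (Gen n) := FreeAlgebra.ι F (Gen.T i)

/-- The free generator `X_j`. -/
abbrev freeX (j : Fin (n + 1)) : FreeAlgebra F (Gen n) := FreeAlgebra.ι F (Gen.X j)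

/-- The free generator `X_j⁻¹`. -/
abbrev freeXinv (j : Fin (n + 1)) : FreeAlgebra F (Gen n) := FreeAlgebra.ι F (Gen.Xinv j)

end Relations

/-- The defining relations of the affine Hecke algebra of type `B_n` with parameters `p`, `q`.
For `i : Fin n`, the indices `i.castSucc`, `i.succ` are `i`, `i + 1` in `Fin (n + 1)`. -/
inductive Rel (F : Type*) [Field F] (p q : Fˣ) (n : ℕ) :
    FreeAlgebra F (Gen n) → FreeAlgebra F (Gen n) → Prop
  /-- `X_j X_j⁻¹ = 1` -/
  | X_Xinv (j : Fin (n + 1)) : Rel F p q n (freeX F n j * freeXinv F n j) 1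
  /-- `X_j⁻¹ X_j = 1` -/
  | Xinv_X (j : Fin (n + 1)) : Rel F p q n (freeXinv F n j * freeX F n j) 1
  /-- `X_j X_k = X_k X_j` -/
  | X_X (j k : Fin (n + 1)) :
      Rel F p q n (freeX F n j * freeX F n k) (freeX F n k * freeX F n j)
  /-- `(T_0 - p) (T_0 + p⁻¹) = 0` -/
  | quad_zero (i : Fin n) (hi : i.val = 0) :
      Rel F p q n ((freeT F n i - algebraMap F _ (p : F)) *
        (freeT F n i + algebraMap F _ ((p⁻¹ : Fˣ) : F))) 0
  /-- `(T_i - q) (T_i + q⁻¹) = 0` for `i ≥ 1` -/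
  | quad (i : Fin n) (hi : 1 ≤ i.val) :
      Rel F p q n ((freeT F n i - algebraMap F _ (q : F)) *
        (freeT F n i + algebraMap F _ ((q⁻¹ : Fˣ) : F))) 0
  /-- `T_i T_{i+1} T_i = T_{i+1} T_i T_{i+1}` for `i ≥ 1` -/
  | braid (i k : Fin n) (hi : 1 ≤ i.val) (hk : k.val = i.val + 1) :
      Rel F p q n (freeT F n i * freeT F n k * freeT F n i)
        (freeT F n k * freeT F n i * freeT F n k)
  /-- `T_i T_k = T_k T_i` for `|i - k| > 1` -/
  | T_T (i k : Fin n) (hik : i.val + 1 < k.val) :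
      Rel F p q n (freeT F n i * freeT F n k) (freeT F n k * freeT F n i)
  /-- `T_1 T_0 T_1 T_0 = T_0 T_1 T_0 T_1` -/
  | braid_zero (i k : Fin n) (hi : i.val = 0) (hk : k.val = 1) :
      Rel F p q n (freeT F n k * freeT F n i * freeT F n k * freeT F n i)
        (freeT F n i * freeT F n k * freeT F n i * freeT F n k)
  /-- `T_0 X_0 T_0 = X_0 X_1` -/
  | T_X_zero (i : Fin n) (hi : i.val = 0) :
      Rel F p q n (freeT F n i * freeX F n i.castSucc * freeT F n i)
        (freeX F n i.castSucc * freeX F n i.succ)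
  /-- `T_i X_j = X_j T_i` for `j ≠ i, i + 1` -/
  | T_X_comm (i : Fin n) (j : Fin (n + 1)) (h : j ≠ i.castSucc) (h' : j ≠ i.succ) :
      Rel F p q n (freeT F n i * freeX F n j) (freeX F n j * freeT F n i)
  /-- `T_i X_i T_i = X_{i+1}` for `i ≥ 1` -/
  | T_X (i : Fin n) (hi : 1 ≤ i.val) :
      Rel F p q n (freeT F n i * freeX F n i.castSucc * freeT F n i) (freeX F n i.succ)

/-- The affine Hecke algebra `H_n` of type `B_n` with parameters `p`, `q`, given by generators and
relations. For `n = 0` it is the Laurent polynomial algebra in `X_0`. -/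
def Hecke (F : Type*) [Field F] (p q : Fˣ) (n : ℕ) : Type _ := RingQuot (Rel F p q n)

instance (F : Type*) [Field F] (p q : Fˣ) (n : ℕ) : Ring (Hecke F p q n) :=
  inferInstanceAs (Ring (RingQuot (Rel F p q n)))

instance (F : Type*) [Field F] (p q : Fˣ) (n : ℕ) : Algebra F (Hecke F p q n) :=
  inferInstanceAs (Algebra F (RingQuot (Rel F p q n)))

section Generators

variable {F : Type*} [Field F] (p q : Fˣ) (n : ℕ)

/-- The quotient map from the free algebra onto `H_n`. -/
def mk : FreeAlgebra F (Gen n) →ₐ[F] Hecke F p q n := RingQuot.mkAlgHom F (Rel F p q n)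

/-- The generator `T_i` of `H_n`. -/
def T (i : Fin n) : Hecke F p q n := mk p q n (freeT F n i)

lemma mk_rel {x y : FreeAlgebra F (Gen n)} (h : Rel F p q n x y) : mk p q n x = mk p q n y :=
  RingQuot.mkAlgHom_rel F h

/-- The invertible generator `X_j` of `H_n`. -/
def X (j : Fin (n + 1)) : (Hecke F p q n)ˣ where
  val := mk p q n (freeX F n j)
  inv := mk p q n (freeXinv F n j)
  val_inv := by rw [← map_mul, mk_rel p q n (Rel.X_Xinv j), map_one]
  inv_val := by rw [← map_mul, mk_rel p q n (Rel.Xinv_X j), map_one]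

/-- Images of the generators of `H_n` under the inclusion into `H_{n+1}`. -/
def inclGen : Gen n → Hecke F p q (n + 1)
  | Gen.T i => T p q (n + 1) i.castSucc
  | Gen.X j => (X p q (n + 1) j.castSucc : Hecke F p q (n + 1))
  | Gen.Xinv j => ((X p q (n + 1) j.castSucc)⁻¹ : (Hecke F p q (n + 1))ˣ)

lemma inclGen_eq (g : Gen n) : FreeAlgebra.lift F (inclGen p q n) (FreeAlgebra.ι F g) =
    mk p q (n + 1) (FreeAlgebra.ι F (match g with
      | Gen.T i => Gen.T i.castSucc
      | Gen.X j => Gen.X j.castSucc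
      | Gen.Xinv j => Gen.Xinv j.castSucc)) := by
  cases g <;> simp [inclGen, T, X]

lemma incl_rel {x y : FreeAlgebra F (Gen n)} (h : Rel F p q n x y) :
    FreeAlgebra.lift F (inclGen p q n) x = FreeAlgebra.lift F (inclGen p q n) y := by
  cases h with
  | X_Xinv j =>
    simp only [map_mul, map_one, inclGen_eq]
    simpa using mk_rel p q (n + 1) (Rel.X_Xinv j.castSucc)
  | Xinv_X j =>
    simp only [map_mul, map_one, inclGen_eq]
    simpa using mk_rel p q (n + 1) (Rel.Xinv_X j.castSucc)
  | X_X j k =>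
    simp only [map_mul, inclGen_eq]
    simpa using mk_rel p q (n + 1) (Rel.X_X j.castSucc k.castSucc)
  | quad_zero i hi =>
    simp only [map_mul, map_sub, map_add, map_zero, AlgHom.commutes, inclGen_eq]
    simpa using mk_rel p q (n + 1) (Rel.quad_zero i.castSucc hi)
  | quad i hi =>
    simp only [map_mul, map_sub, map_add, map_zero, AlgHom.commutes, inclGen_eq]
    simpa using mk_rel p q (n + 1) (Rel.quad i.castSucc hi)
  | braid i k hi hk =>
    simp only [map_mul, inclGen_eq]
    simpa using mk_rel p q (n + 1) (Rel.braid i.castSucc k.castSucc hi hk)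
  | T_T i k hik =>
    simp only [map_mul, inclGen_eq]
    simpa using mk_rel p q (n + 1) (Rel.T_T i.castSucc k.castSucc hik)
  | braid_zero i k hi hk =>
    simp only [map_mul, inclGen_eq]
    simpa using mk_rel p q (n + 1) (Rel.braid_zero i.castSucc k.castSucc hi hk)
  | T_X_zero i hi =>
    simp only [map_mul, inclGen_eq]
    simpa using mk_rel p q (n + 1) (Rel.T_X_zero i.castSucc hi)
  | T_X_comm i j h h' =>
    simp only [map_mul, inclGen_eq]
    have h1 : j.castSucc ≠ i.castSucc.castSucc := fun e => h (Fin.castSucc_injective _ e)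
    have h2 : j.castSucc ≠ i.castSucc.succ := fun e => h' (by
      apply Fin.castSucc_injective; rw [e, Fin.succ_castSucc])
    simpa using mk_rel p q (n + 1) (Rel.T_X_comm i.castSucc j.castSucc h1 h2)
  | T_X i hi =>
    simp only [map_mul, inclGen_eq]
    simpa using mk_rel p q (n + 1) (Rel.T_X i.castSucc hi)

/-- The natural map `H_n → H_{n+1}`, sending `T_i` to `T_i` and `X_j` to `X_j`. -/
def incl : Hecke F p q n →ₐ[F] Hecke F p q (n + 1) :=
  RingQuot.liftAlgHom F ⟨FreeAlgebra.lift F (inclGen p q n), fun _ _ h => incl_rel p q n h⟩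

lemma incl_mk (x : FreeAlgebra F (Gen n)) :
    incl p q n (mk p q n x) = FreeAlgebra.lift F (inclGen p q n) x :=
  RingQuot.liftAlgHom_mkAlgHom_apply F _ _ x

end Generators

/-- For an invertible element `u` of an algebra `A`, the algebra homomorphism
`F[t, t⁻¹] → A` with `t ↦ u`. -/
def laurentEval {F A : Type*} [Field F] [Ring A] [Algebra F A] (u : Aˣ) : F[T;T⁻¹] →ₐ[F] A :=
  AddMonoidAlgebra.lift F A ℤ ((Units.coeHom A).comp (zpowersHom Aˣ u))

section Parabolic

variable {F : Type*} [Field F] (p q : Fˣ) (n : ℕ)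

lemma commute_X_last (g : Gen n) :
    Commute (inclGen p q n g) (X p q (n + 1) (Fin.last (n + 1)) : Hecke F p q (n + 1)) := by
  have hX (j : Fin (n + 1)) : Commute (X p q (n + 1) j.castSucc : Hecke F p q (n + 1))
      (X p q (n + 1) (Fin.last (n + 1)) : Hecke F p q (n + 1)) := by
    have := mk_rel p q (n + 1) (Rel.X_X j.castSucc (Fin.last (n + 1)))
    rwa [map_mul, map_mul] at this
  cases g with
  | T i =>
    have h1 : Fin.last (n + 1) ≠ i.castSucc.castSucc := (Fin.castSucc_lt_last _).ne'
    have h2 : Fin.last (n + 1) ≠ i.castSucc.succ := by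
      rw [Fin.succ_castSucc]; exact (Fin.castSucc_lt_last _).ne'
    have := mk_rel p q (n + 1) (Rel.T_X_comm i.castSucc (Fin.last (n + 1)) h1 h2)
    rwa [map_mul, map_mul] at this
  | X j => exact hX j
  | Xinv j => exact (hX j).units_inv_left

lemma commute_incl (x : Hecke F p q n) :
    Commute (incl p q n x) (X p q (n + 1) (Fin.last (n + 1)) : Hecke F p q (n + 1)) := by
  obtain ⟨x, rfl⟩ : ∃ y, mk p q n y = x := RingQuot.mkAlgHom_surjective F (Rel F p q n) x
  rw [incl_mk]
  induction x using FreeAlgebra.induction with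
  | grade0 r => rw [AlgHom.commutes]; exact Algebra.commutes r _
  | grade1 g => rw [FreeAlgebra.lift_ι_apply]; exact commute_X_last p q n g
  | mul a b ha hb => rw [map_mul]; exact ha.mul_left hb
  | add a b ha hb => rw [map_add]; exact ha.add_left hb

lemma commute_incl_laurentEval (x : Hecke F p q n) (f : F[T;T⁻¹]) :
    Commute (incl p q n x) (laurentEval (F := F) (X p q (n + 1) (Fin.last (n + 1))) f) := by
  induction f using AddMonoidAlgebra.induction_linear with
  | zero => rw [map_zero]; exact Commute.zero_right _
  | add f g hf hg => rw [map_add]; exact hf.add_right hg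
  | single k c =>
    rw [laurentEval, AddMonoidAlgebra.lift_single]
    refine Commute.smul_right ?_ c
    exact (commute_incl p q n x).units_zpow_right k

/-- The parabolic algebra `H_{n,1} ≅ H_n ⊗ F[X_{n+1}^{±1}]`. -/
abbrev Parabolic (F : Type*) [Field F] (p q : Fˣ) (n : ℕ) : Type _ := Hecke F p q n ⊗[F] F[T;T⁻¹]

/-- The inclusion `H_{n,1} → H_{n+1}`: it sends the generators `T_i`, `X_j` of `H_n` to `T_i`, `X_j`
and the Laurent variable to `X_{n+1}`, so that its image is the subalgebra of `H_{n+1}` generated by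
`T_0, …, T_{n-1}` and `X_0^{±1}, …, X_{n+1}^{±1}`. -/
def parabolicIncl : Parabolic F p q n →ₐ[F] Hecke F p q (n + 1) :=
  Algebra.TensorProduct.lift (incl p q n) (laurentEval (X p q (n + 1) (Fin.last (n + 1))))
    (commute_incl_laurentEval p q n)

end Parabolic

section Modules

variable {F : Type*} [Field F]

/-- The outer tensor product of a representation of `A` on `V` and one of `B` on `W`: the
representation of `A ⊗ B` on `V ⊗ W` with `(a ⊗ b) (v ⊗ w) = a v ⊗ b w`. -/
def outer {A B V W : Type*} [Ring A] [Algebra F A] [Ring B] [Algebra F B]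
    [AddCommGroup V] [Module F V] [AddCommGroup W] [Module F W]
    (ρ : A →ₐ[F] Module.End F V) (σ : B →ₐ[F] Module.End F W) :
    A ⊗[F] B →ₐ[F] Module.End F (V ⊗[F] W) :=
  Module.endTensorEndAlgHom.comp (Algebra.TensorProduct.map ρ σ)

/-- The one-dimensional representation `(a)` of `F[t, t⁻¹]`, on which `t` acts as the scalar `a`. -/
def oneDim (a : Fˣ) : F[T;T⁻¹] →ₐ[F] Module.End F F :=
  (Algebra.lsmul F F F).comp (laurentEval a)

/-- The relations `b φ(x) ⊗ v = b ⊗ x v` of the tensor product over `A`. -/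
def indRel {A B V : Type*} [Ring A] [Algebra F A] [Ring B] [Algebra F B]
    [AddCommGroup V] [Module F V] (φ : A →ₐ[F] B) (ρ : A →ₐ[F] Module.End F V) :
    Submodule B (B ⊗[F] V) :=
  Submodule.span B
    {z | ∃ (b : B) (x : A) (v : V), z = (b * φ x) ⊗ₜ[F] v - b ⊗ₜ[F] (ρ x v)}

/-- The induced `B`-module `B ⊗_A V` of a representation of `A` on `V` along `φ : A → B`. -/
abbrev Ind {A B V : Type*} [Ring A] [Algebra F A] [Ring B] [Algebra F B]
    [AddCommGroup V] [Module F V] (φ : A →ₐ[F] B) (ρ : A →ₐ[F] Module.End F V) : Type _ :=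
  (B ⊗[F] V) ⧸ indRel φ ρ

/-- The `H_{n+1}`-module `f_a N = ind_{n,1}^{n+1} (N ⊠ (a))` for an `H_n`-module `N`. -/
abbrev fInd (p q : Fˣ) (n : ℕ) (a : Fˣ) (N : Type*) [AddCommGroup N] [Module F N]
    [Module (Hecke F p q n) N] [IsScalarTower F (Hecke F p q n) N] : Type _ :=
  Ind (parabolicIncl p q n) (outer (Algebra.lsmul F F N : Hecke F p q n →ₐ[F] _) (oneDim a))

end Modules

end HeckeB

end

/-! Write `M` for `f_a N`, a module over `H_{n+1}`, and `ι : N → M` for the canonical map. Since `ι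
N` generates `M`, an endomorphism of `M` is determined by its restriction to `N`, which is an
`H_n`-map into the `a`-eigenspace of `X_{n+1}`. So it suffices to bound the space `K ∋ ι` of all
such maps; if `ι = 0`, all these restrictions vanish.

Let `E` be the part of the eigenspace `X_{n+1} = a` on which `X_b, …, X_n` have only the generalized
eigenvalue `a`, where `b ≥ 1` is the least index with `V = ι N ∩ E ≠ 0`. The heart of the proof is
`dim E ≤ 2 dim V`. It compares two estimates for `D`, the common generalized `a`-eigenspace of `X_b,
…, X_{n+1}` in `M`.

Upper bound (`finrank_gen_le`): `M` is filtered by the images of `N` under the `2n + 2` coset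
representatives, and the `X_i` act triangularly, with indices shifted by each representative. By
minimality of `b`, only the `2(n + 2 - b)` representatives that move the last coordinate to a
position `≥ b` contribute, each at most `dim V`. Spanning is enough here; no basis theorem enters.

Lower bound (`run_independent`): `T_b, …, T_n` preserve `D ⊇ E`, and since `q² ≠ 1` the `n + 2 - b`
subspaces `T_j ⋯ T_n E` are independent, each of dimension `dim E`.

To conclude (`exists_le_span_pair`), every `f ∈ K` maps `ι⁻¹ E` to `E`. If some `g ∈ K` leaves `ι
N`, simplicity of `N` makes `ι⁻¹ E → E / V` injective, hence bijective by dimension. For `f ∈ K`, an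
eigenvector of `g⁻¹ f` yields `d` such that `f - d g` maps a nonzero vector, hence all of `N`, into
`ι N`. By Schur's lemma `f - d g` is a multiple of `ι`. -/

/-- Operators on a vector space satisfying the relations of the affine Hecke algebra of type
`B_{n+1}` (Bernstein generators indexed by natural numbers; indices out of range are arbitrary). -/
structure HeckeOps (F M : Type*) [Field F] [AddCommGroup M] [Module F M] (n : ℕ) (c₀ c : F) where
  T : ℕ → Module.End F M
  X : ℕ → Module.End F M
  Xi : ℕ → Module.End F M
  X_Xi : ∀ j ≤ n + 1, X j * Xi j = 1
  Xi_X : ∀ j ≤ n + 1, Xi j * X j = 1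
  X_X : ∀ j ≤ n + 1, ∀ k ≤ n + 1, X j * X k = X k * X j
  quad_zero : T 0 * T 0 = c₀ • T 0 + 1
  quad : ∀ i, 1 ≤ i → i ≤ n → T i * T i = c • T i + 1
  braid : ∀ i, 1 ≤ i → i + 1 ≤ n → T i * T (i + 1) * T i = T (i + 1) * T i * T (i + 1)
  T_T : ∀ i k, i + 1 < k → k ≤ n → T i * T k = T k * T i
  braid_zero : 1 ≤ n → T 1 * T 0 * T 1 * T 0 = T 0 * T 1 * T 0 * T 1
  T_X_zero : T 0 * X 0 * T 0 = X 0 * X 1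
  T_X_comm : ∀ i ≤ n, ∀ j ≤ n + 1, j ≠ i → j ≠ i + 1 → T i * X j = X j * T i
  T_X : ∀ i, 1 ≤ i → i ≤ n → T i * X i * T i = X (i + 1)

/-! ### Commutation of the `X_j` with the `T_i` -/

namespace HeckeOps

variable {F M : Type*} [Field F] [AddCommGroup M] [Module F M] {n : ℕ} {c₀ c : F}
  (R : HeckeOps F M n c₀ c)

lemma T_T_apply {i k : ℕ} (h : i + 1 < k ∨ k + 1 < i) (hi : i ≤ n) (hk : k ≤ n) (u : M) :
    R.T i (R.T k u) = R.T k (R.T i u) := by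
  rcases h with h | h
  · exact LinearMap.congr_fun (R.T_T i k h hk) u
  · exact (LinearMap.congr_fun (R.T_T k i h hi) u).symm

lemma braid_apply {i : ℕ} (h : 1 ≤ i) (h' : i + 1 ≤ n) (u : M) :
    R.T i (R.T (i + 1) (R.T i u)) = R.T (i + 1) (R.T i (R.T (i + 1) u)) :=
  LinearMap.congr_fun (R.braid i h h') u

lemma braid_zero_apply (h : 1 ≤ n) (u : M) :
    R.T 1 (R.T 0 (R.T 1 (R.T 0 u))) = R.T 0 (R.T 1 (R.T 0 (R.T 1 u))) :=
  LinearMap.congr_fun (R.braid_zero h) u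

lemma T_X_apply {i j : ℕ} (hi : i ≤ n) (hj : j ≤ n + 1) (h : j ≠ i) (h' : j ≠ i + 1) (u : M) :
    R.X j (R.T i u) = R.T i (R.X j u) :=
  (LinearMap.congr_fun (R.T_X_comm i hi j hj h h') u).symm

lemma X_X_apply {i j : ℕ} (hi : i ≤ n + 1) (hj : j ≤ n + 1) (u : M) :
    R.X i (R.X j u) = R.X j (R.X i u) :=
  LinearMap.congr_fun (R.X_X i hi j hj) u

lemma X_Xi_apply {j : ℕ} (hj : j ≤ n + 1) (u : M) : R.X j (R.Xi j u) = u :=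
  LinearMap.congr_fun (R.X_Xi j hj) u

lemma Xi_X_apply {j : ℕ} (hj : j ≤ n + 1) (u : M) : R.Xi j (R.X j u) = u :=
  LinearMap.congr_fun (R.Xi_X j hj) u

lemma quad_exists {i : ℕ} (hi : i ≤ n) : ∃ d : F, ∀ u, R.T i (R.T i u) = d • R.T i u + u := by
  rcases Nat.eq_zero_or_pos i with rfl | h
  · exact ⟨c₀, fun u => LinearMap.congr_fun R.quad_zero u⟩
  · exact ⟨c, fun u => LinearMap.congr_fun (R.quad i h hi) u⟩

/-- `X_{i+1} T_i = T_i X_i + c X_{i+1}` -/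
lemma X_succ_T {i : ℕ} (h : 1 ≤ i) (hi : i ≤ n) (u : M) :
    R.X (i + 1) (R.T i u) = R.T i (R.X i u) + c • R.X (i + 1) u := by
  have h1 : R.X (i + 1) * R.T i = R.T i * R.X i + c • R.X (i + 1) := by
    calc R.X (i + 1) * R.T i = R.T i * R.X i * (R.T i * R.T i) := by
          rw [← R.T_X i h hi]; simp only [mul_assoc]
      _ = c • (R.T i * R.X i * R.T i) + R.T i * R.X i := by
          rw [R.quad i h hi, mul_add, mul_one, mul_smul_comm]
      _ = _ := by rw [R.T_X i h hi, add_comm]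
  exact LinearMap.congr_fun h1 u

/-- `X_i T_i = T_i X_{i+1} - c X_{i+1}` -/
lemma X_T {i : ℕ} (h : 1 ≤ i) (hi : i ≤ n) (u : M) :
    R.X i (R.T i u) = R.T i (R.X (i + 1) u) - c • R.X (i + 1) u := by
  have h1 : R.T i * R.X (i + 1) = R.X i * R.T i + c • R.X (i + 1) := by
    calc R.T i * R.X (i + 1) = (R.T i * R.T i) * (R.X i * R.T i) := by
          rw [← R.T_X i h hi]; simp only [mul_assoc]
      _ = c • (R.T i * R.X i * R.T i) + R.X i * R.T i := by
          rw [R.quad i h hi, add_mul, one_mul, smul_mul_assoc]; simp only [mul_assoc]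
      _ = _ := by rw [R.T_X i h hi, add_comm]
  rw [eq_sub_iff_add_eq]
  exact (LinearMap.congr_fun h1 u).symm

/-- `X_0 T_0 = T_0 X_0 X_1 - c₀ X_0 X_1` -/
lemma X_zero_T (u : M) :
    R.X 0 (R.T 0 u) = R.T 0 (R.X 0 (R.X 1 u)) - c₀ • R.X 0 (R.X 1 u) := by
  have h1 : R.T 0 * (R.X 0 * R.X 1) = R.X 0 * R.T 0 + c₀ • (R.X 0 * R.X 1) := by
    calc R.T 0 * (R.X 0 * R.X 1) = (R.T 0 * R.T 0) * (R.X 0 * R.T 0) := by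
          rw [← R.T_X_zero]; simp only [mul_assoc]
      _ = c₀ • (R.T 0 * R.X 0 * R.T 0) + R.X 0 * R.T 0 := by
          rw [R.quad_zero, add_mul, one_mul, smul_mul_assoc]; simp only [mul_assoc]
      _ = _ := by rw [R.T_X_zero, add_comm]
  rw [eq_sub_iff_add_eq]
  exact (LinearMap.congr_fun h1 u).symm

/-- `T_0 X_0 = X_0 X_1 T_0 - c₀ X_0 X_1` -/
lemma T_X_zero' (u : M) :
    R.T 0 (R.X 0 u) = R.X 0 (R.X 1 (R.T 0 u)) - c₀ • R.X 0 (R.X 1 u) := by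
  have h1 : R.X 0 * R.X 1 * R.T 0 = R.T 0 * R.X 0 + c₀ • (R.X 0 * R.X 1) := by
    calc R.X 0 * R.X 1 * R.T 0 = R.T 0 * R.X 0 * (R.T 0 * R.T 0) := by
          rw [← R.T_X_zero]; simp only [mul_assoc]
      _ = c₀ • (R.T 0 * R.X 0 * R.T 0) + R.T 0 * R.X 0 := by
          rw [R.quad_zero, mul_add, mul_one, mul_smul_comm]
      _ = _ := by rw [R.T_X_zero, add_comm]
  rw [eq_sub_iff_add_eq]
  exact (LinearMap.congr_fun h1 u).symm

/-- `X_1 T_0 = T_0 X_1⁻¹ + c₀ (X_1 + 1)` -/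
lemma X_one_T_zero (u : M) :
    R.X 1 (R.T 0 u) = R.T 0 (R.Xi 1 u) + c₀ • (R.X 1 u + u) := by
  have h0 : (0 : ℕ) ≤ n + 1 := Nat.zero_le _
  have h1 : 1 ≤ n + 1 := Nat.le_add_left 1 n
  obtain ⟨v, rfl⟩ : ∃ v, R.X 1 v = u := ⟨_, R.X_Xi_apply h1 u⟩
  rw [R.Xi_X_apply h1]
  -- `X_0` is injective, so the identity may be checked after applying it; there it follows by
  -- equating two expressions for `T_0 X_0 X_1 v`.
  apply (Function.LeftInverse.injective fun x => R.Xi_X_apply h0 x)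
  have h2 := R.T_X_zero' (R.X 1 v)
  rw [← eq_sub_iff_add_eq.mp (R.X_zero_T v)] at h2
  simp only [map_add, map_smul]
  rw [eq_sub_iff_add_eq] at h2
  rw [smul_add, ← h2]
  abel

end HeckeOps

/-! ### Linear algebra: lifting generalized eigenvectors -/

/-- If `f ^ k x` lies in the `f`-stable subspace `I`, then `x` is congruent modulo `I` to a vector
killed by a power of `f`, which may be chosen in any `f`-stable subspace that contains `x`. -/
lemma exists_nilpotent_lift {F M : Type*} [Field F] [AddCommGroup M] [Module F M]
    [FiniteDimensional F M] (f : Module.End F M) (W I : Submodule F M)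
    (hW : ∀ x ∈ W, f x ∈ W) (hI : ∀ x ∈ I, f x ∈ I) {x : M} (hx : x ∈ W) {k : ℕ}
    (hk : (f ^ k) x ∈ I) : ∃ z ∈ W, (∃ j : ℕ, (f ^ j) z = 0) ∧ x - z ∈ I := by
  have hpoly (S : Submodule F M) (hS : ∀ x ∈ S, f x ∈ S) (r : Polynomial F) (y : M) (hy : y ∈ S) :
      Polynomial.aeval f r y ∈ S := by
    have hpow (j : ℕ) : (f ^ j) y ∈ S := by
      induction j with
      | zero => simpa using hy
      | succ j ih => rw [pow_succ', Module.End.mul_apply]; exact hS _ ih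
    induction r using Polynomial.induction_on' with
    | add r s hr hs => rw [map_add, LinearMap.add_apply]; exact S.add_mem hr hs
    | monomial j b =>
      rw [Polynomial.aeval_monomial, Module.algebraMap_end_eq_smul_id, smul_mul_assoc,
        LinearMap.smul_apply]
      exact S.smul_mem _ (hpow j)
  have hne : minpoly F f ≠ 0 := minpoly.ne_zero (Algebra.IsIntegral.isIntegral f)
  obtain ⟨g, hg, hdvd⟩ := Polynomial.exists_eq_pow_rootMultiplicity_mul_and_not_dvd _ hne 0
  set K := Polynomial.rootMultiplicity 0 (minpoly F f)
  rw [map_zero, sub_zero] at hg hdvd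
  have hcop : IsCoprime (Polynomial.X ^ (K + k)) g :=
    IsCoprime.pow_left ((Polynomial.irreducible_X.coprime_iff_not_dvd).2 hdvd)
  obtain ⟨u, v, huv⟩ := hcop
  -- Bézout gives `x = u(f) f^(K+k) x + (v g)(f) x`. The first summand lies in `I`; the second is
  -- killed by `f ^ K` because `X ^ K * g` is the minimal polynomial.
  refine ⟨Polynomial.aeval f (v * g) x, hpoly W hW _ _ hx, ⟨K, ?_⟩, ?_⟩
  · have : Polynomial.aeval f (v * minpoly F f) x = 0 := by
      rw [map_mul, minpoly.aeval, mul_zero, LinearMap.zero_apply]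
    rw [← this, hg]
    have h2 : v * (Polynomial.X ^ K * g) = Polynomial.X ^ K * (v * g) := by ring
    rw [h2, map_mul (Polynomial.aeval f) (Polynomial.X ^ K), map_pow, Polynomial.aeval_X,
      Module.End.mul_apply]
  · have : x - Polynomial.aeval f (v * g) x =
        Polynomial.aeval f (u * Polynomial.X ^ K) ((f ^ k) x) := by
      have h3 := congrArg (fun r => Polynomial.aeval f r x) huv
      simp only [map_add, LinearMap.add_apply, map_one, Module.End.one_apply] at h3
      rw [← eq_sub_iff_add_eq.mpr h3, pow_add, ← mul_assoc, map_mul, map_pow, Polynomial.aeval_X,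
        Module.End.mul_apply]
    rw [this]
    exact hpoly I hI _ _ hk

/-- The version of `exists_nilpotent_lift` for finitely many commuting operators. -/
lemma exists_nilpotent_lift_finset {F M : Type*} [Field F] [AddCommGroup M] [Module F M]
    [FiniteDimensional F M] (S : Finset ℕ) (f : ℕ → Module.End F M) (W I : Submodule F M)
    (hf : ∀ i ∈ S, ∀ j ∈ S, Commute (f i) (f j))
    (hW : ∀ i ∈ S, ∀ x ∈ W, f i x ∈ W) (hI : ∀ i ∈ S, ∀ x ∈ I, f i x ∈ I) {x : M} (hx : x ∈ W)
    (hk : ∀ i ∈ S, ∃ k : ℕ, (f i ^ k) x ∈ I) :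
    ∃ z ∈ W, (∀ i ∈ S, ∃ j : ℕ, (f i ^ j) z = 0) ∧ x - z ∈ I := by
  induction S using Finset.induction_on with
  | empty => exact ⟨x, hx, by simp, by simp⟩
  | insert a S ha ih =>
    obtain ⟨z, hzW, hz, hxz⟩ := ih (fun i hi j hj => hf i (by simp [hi]) j (by simp [hj]))
      (fun i hi => hW i (by simp [hi])) (fun i hi => hI i (by simp [hi]))
      (fun i hi => hk i (by simp [hi]))
    obtain ⟨k, hk⟩ := hk a (by simp)
    have hIa := hI a (by simp)
    have hpow (j : ℕ) : ∀ y ∈ I, (f a ^ j) y ∈ I := by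
      induction j with
      | zero => simp
      | succ j ih => intro y hy; rw [pow_succ', Module.End.mul_apply]; exact hIa _ (ih y hy)
    -- Lifting for `f a` inside the vectors already nilpotent for the other operators keeps what was
    -- achieved; this subspace is `f a`-stable by commutativity.
    let W' : Submodule F M := W ⊓ ⨅ i ∈ S, (f i).maxGenEigenspace 0
    have hW' (y : M) : y ∈ W' ↔ y ∈ W ∧ ∀ i ∈ S, ∃ j : ℕ, (f i ^ j) y = 0 := by
      simp [W', Module.End.mem_maxGenEigenspace]
    have hzk : (f a ^ k) z ∈ I := by
      have := I.sub_mem hk (hpow k _ hxz)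
      rwa [map_sub, sub_sub_cancel] at this
    obtain ⟨z', hz', hz'', hzz'⟩ := exists_nilpotent_lift (f a) W' I (fun y hy => by
        rw [hW'] at hy ⊢
        refine ⟨hW a (by simp) y hy.1, fun i hi => ?_⟩
        obtain ⟨j, hj⟩ := hy.2 i hi
        refine ⟨j, ?_⟩
        have := ((hf i (by simp [hi]) a (by simp)).pow_left j).eq
        rw [← Module.End.mul_apply, this, Module.End.mul_apply, hj, map_zero])
      hIa ((hW' z).2 ⟨hzW, hz⟩) hzk
    rw [hW'] at hz'
    refine ⟨z', hz'.1, fun i hi => ?_, ?_⟩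
    · rcases Finset.mem_insert.1 hi with rfl | hi
      · exact hz''
      · exact hz'.2 i hi
    · simpa using I.add_mem hxz hzz'

/-- Adjoining a subspace of dimension `dim C` raises the dimension of an intersection by at most
`dim C`. -/
lemma finrank_le_of_le_sup {F M : Type*} [Field F] [AddCommGroup M] [Module F M]
    [FiniteDimensional F M] {A B C : Submodule F M} (h : A ≤ B ⊔ C) :
    Module.finrank F A ≤ Module.finrank F (A ⊓ B : Submodule F M) + Module.finrank F C := by
  have h1 := Submodule.finrank_sup_add_finrank_inf_eq A B
  have h2 := Submodule.finrank_mono (sup_le h le_sup_left : A ⊔ B ≤ B ⊔ C)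
  have h3 := Submodule.finrank_add_le_finrank_add_finrank B C
  omega

/-! ### The filtration by coset representatives -/

namespace HeckeOps

variable {F M : Type*} [Field F] [AddCommGroup M] [Module F M] {n : ℕ} {c₀ c : F}
  (R : HeckeOps F M n c₀ c)

/-- A subspace stable under the operators of `H_n`, on which `X_{n+1}` acts as the scalar `a`. -/
structure IsBase (R : HeckeOps F M n c₀ c) (a : F) (N : Submodule F M) : Prop where
  T_mem : ∀ i < n, ∀ x ∈ N, R.T i x ∈ N
  X_mem : ∀ i ≤ n, ∀ x ∈ N, R.X i x ∈ N
  X_last : ∀ x ∈ N, R.X (n + 1) x = a • x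

/-- The index of the letter added in the `l`-th step to the word
`T_n ⋯ T_1 T_0 T_1 ⋯ T_n`, read from the right. -/
def letterIdx (n l : ℕ) : ℕ := if l ≤ n then n - l else l - n

/-- The product of the last `l` letters of `T_n ⋯ T_1 T_0 T_1 ⋯ T_n`; these are the minimal
coset representatives of `W(B_{n+1}) / W(B_n)`. -/
def coset : ℕ → Module.End F M
  | 0 => 1
  | l + 1 => R.T (letterIdx n l) * coset l

/-- The span of the images of `N` under the first `l` coset representatives. -/
def filt (N : Submodule F M) : ℕ → Submodule F M
  | 0 => ⊥
  | l + 1 => filt N l ⊔ N.map (R.coset l)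

lemma coset_zero (x : M) : R.coset 0 x = x := rfl

lemma coset_succ (l : ℕ) (x : M) : R.coset (l + 1) x = R.T (letterIdx n l) (R.coset l x) := rfl

variable {N : Submodule F M} {a : F}

lemma filt_mono : Monotone (R.filt N) :=
  monotone_nat_of_le_succ fun _ => le_sup_left

lemma coset_mem_filt {l : ℕ} {x : M} (hx : x ∈ N) : R.coset l x ∈ R.filt N (l + 1) :=
  Submodule.mem_sup_right (Submodule.mem_map_of_mem hx)

lemma filt_induction {l : ℕ} {S : Submodule F M}
    (h : ∀ k < l, ∀ x ∈ N, R.coset k x ∈ S) : R.filt N l ≤ S := by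
  induction l with
  | zero => exact bot_le
  | succ l ih =>
    refine sup_le (ih fun k hk => h k (by omega)) ?_
    rintro _ ⟨x, hx, rfl⟩
    exact h l (by omega) x hx

/-- Unless `T_i` is the next or the last letter, it passes through a coset representative. -/
lemma T_coset (hN : R.IsBase a N) (l : ℕ) : ∀ i, l ≤ 2 * n + 1 → i ≤ n → i ≠ letterIdx n l →
    (∀ k, l = k + 1 → i ≠ letterIdx n k) → ∀ x ∈ N, ∃ y ∈ N, R.T i (R.coset l x) = R.coset l y := by
  induction l using Nat.strong_induction_on with
  | _ l ih =>
  intro i hl hi h1 h2 x hx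
  rcases l with _ | l
  · refine ⟨R.T i x, hN.T_mem i ?_ x hx, rfl⟩
    simp only [letterIdx, Nat.zero_le, if_true] at h1
    omega
  have h2 := h2 l rfl
  by_cases hfar : i + 1 < letterIdx n l ∨ letterIdx n l + 1 < i
  · obtain ⟨y, hy, hxy⟩ := ih l (by omega) i (by omega) hi h2 (fun k hk => by
      subst hk
      unfold letterIdx at *
      split_ifs at * <;> omega) x hx
    refine ⟨y, hy, ?_⟩
    rw [coset_succ, R.T_T_apply hfar hi (by unfold letterIdx; split_ifs <;> omega), hxy,
      coset_succ]
  obtain ⟨k, rfl⟩ : ∃ k, l = k + 1 := by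
    rcases l with _ | k
    · unfold letterIdx at h1 h2 hfar
      split_ifs at h1 h2 hfar <;> omega
    · exact ⟨k, rfl⟩
  -- `T_i` is adjacent to the last letter and is not the next one, so it equals the letter just
  -- before the last: a braid relation applies.
  have hik : i = letterIdx n k := by
    unfold letterIdx at *
    split_ifs at * <;> omega
  -- Here the word begins with `T_1 T_0 T_1` and `i = 0`, which calls for the four-letter relation.
  -- Otherwise the three-letter relation trades `T_i` for the last letter, which then passes through
  -- the shorter word.
  by_cases hz : k + 1 = n + 1
  · obtain rfl : k = n := by omega
    have h3 : letterIdx k k = 0 := by simp [letterIdx]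
    have h4 : letterIdx k (k + 1) = 1 := by simp [letterIdx]
    obtain ⟨m, rfl⟩ : ∃ m, k = m + 1 := by
      rcases k with _ | m
      · omega
      · exact ⟨m, rfl⟩
    have h5 : letterIdx (m + 1) m = 1 := by simp [letterIdx]
    obtain ⟨y, hy, hxy⟩ := ih m (by omega) 0 (by omega) (by omega) (by omega) (fun j hj => by
      subst hj
      unfold letterIdx
      split_ifs <;> omega) x hx
    refine ⟨y, hy, ?_⟩
    simp only [coset_succ, h3, h4, h5, hik]
    rw [← R.braid_zero_apply (by omega), hxy]
  · obtain ⟨y, hy, hxy⟩ := ih k (by omega) (letterIdx n (k + 1)) (by omega)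
      (by unfold letterIdx; split_ifs <;> omega)
      (by unfold letterIdx; split_ifs <;> omega) (fun j hj => by
        subst hj
        unfold letterIdx at *
        split_ifs at * <;> omega) x hx
    refine ⟨y, hy, ?_⟩
    simp only [coset_succ]
    rw [← hxy, hik]
    by_cases hkn : k < n
    · have : letterIdx n k = letterIdx n (k + 1) + 1 := by
        unfold letterIdx; split_ifs <;> omega
      rw [this]
      refine (R.braid_apply ?_ ?_ _).symm <;>
        · unfold letterIdx at h1 hik ⊢
          split_ifs at * <;> omega
    · have : letterIdx n (k + 1) = letterIdx n k + 1 := by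
        unfold letterIdx; split_ifs <;> omega
      rw [this]
      refine R.braid_apply ?_ ?_ _ <;> · unfold letterIdx; split_ifs <;> omega

lemma T_coset_mem (hN : R.IsBase a N) {l i : ℕ} (hl : l ≤ 2 * n + 1) (hi : i ≤ n)
    {x : M} (hx : x ∈ N) (h : i ≠ letterIdx n l) :
    R.T i (R.coset l x) ∈ R.filt N (l + 1) := by
  by_cases h2 : ∀ k, l = k + 1 → i ≠ letterIdx n k
  · obtain ⟨y, hy, hxy⟩ := R.T_coset hN l i hl hi h h2 x hx
    rw [hxy]
    exact R.coset_mem_filt hy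
  · push Not at h2
    obtain ⟨k, rfl, rfl⟩ := h2
    obtain ⟨d, hd⟩ := R.quad_exists hi
    rw [coset_succ, hd, ← coset_succ]
    exact Submodule.add_mem _ (Submodule.smul_mem _ _ (R.coset_mem_filt hx))
      (R.filt_mono (Nat.le_succ _) (R.coset_mem_filt hx))

lemma T_mem_filt_succ (hN : R.IsBase a N) {l i : ℕ} (hl : l ≤ 2 * n + 2) (hi : i ≤ n)
    {u : M} (hu : u ∈ R.filt N l) : R.T i u ∈ R.filt N (l + 1) := by
  have : R.filt N l ≤ (R.filt N (l + 1)).comap (R.T i) := by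
    refine R.filt_induction fun k hk x hx => ?_
    by_cases h : i = letterIdx n k
    · subst h
      exact R.filt_mono (by omega : k + 2 ≤ l + 1) (R.coset_mem_filt (l := k + 1) hx)
    · exact R.filt_mono (by omega : k + 1 ≤ l + 1) (R.T_coset_mem hN (by omega) hi hx h)
  exact this hu

/-- The full word has no next letter: `letterIdx n (2 * n + 1) = n + 1` exceeds every admissible
`i`. So the filtration stops growing here. -/
lemma T_mem_filt_last (hN : R.IsBase a N) {i : ℕ} (hi : i ≤ n)
    {u : M} (hu : u ∈ R.filt N (2 * n + 2)) : R.T i u ∈ R.filt N (2 * n + 2) := by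
  have : R.filt N (2 * n + 2) ≤ (R.filt N (2 * n + 2)).comap (R.T i) := by
    refine R.filt_induction fun k hk x hx => ?_
    by_cases h : i = letterIdx n k
    · subst h
      have : k + 2 ≤ 2 * n + 2 := by
        unfold letterIdx at hi
        split_ifs at hi <;> omega
      exact R.filt_mono this (R.coset_mem_filt (l := k + 1) hx)
    · exact R.filt_mono (by omega : k + 1 ≤ 2 * n + 2) (R.T_coset_mem hN (by omega) hi hx h)
  exact this hu

instance finiteDimensional_filt [FiniteDimensional F N] (l : ℕ) :
    FiniteDimensional F (R.filt N l) := by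
  induction l with
  | zero => exact inferInstanceAs (FiniteDimensional F (⊥ : Submodule F M))
  | succ l ih =>
    exact inferInstanceAs (FiniteDimensional F (R.filt N l ⊔ N.map (R.coset l) : Submodule F M))

/-- An injective endomorphism of a finite-dimensional space is onto. -/
lemma Xi_mem {S : Submodule F M} [FiniteDimensional F S] {i : ℕ} (hi : i ≤ n + 1)
    (hS : ∀ u ∈ S, R.X i u ∈ S) {u : M} (hu : u ∈ S) : R.Xi i u ∈ S := by
  have hinj : Function.Injective ((R.X i).restrict hS) := fun v w h =>
    Subtype.ext ((Function.LeftInverse.injective fun x => R.Xi_X_apply hi x)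
      (congrArg Subtype.val h))
  obtain ⟨v, hv⟩ := LinearMap.injective_iff_surjective.1 hinj ⟨u, hu⟩
  have hv' : R.X i v = u := congrArg Subtype.val hv
  rw [← hv', R.Xi_X_apply hi]
  exact v.2

/-- The position to which the `l`-th coset representative moves the last coordinate. -/
def posIdx (n l : ℕ) : ℕ := if l ≤ n then n + 1 - l else l - n

/-- The leading terms and the stability of the filtration are proved together, since the correction
terms in the relations between `X` and `T` must be absorbed by stable lower steps. The scalar `b` at
position `posIdx n l` starts as `a` and is inverted when the word crosses `T_0`. -/
lemma X_coset_aux (hN : R.IsBase a N) (ha : a ≠ 0) [FiniteDimensional F N] (l : ℕ)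
    (hl : l ≤ 2 * n + 2) : (l ≤ 2 * n + 1 →
    (∀ i, 1 ≤ i → i < posIdx n l → ∀ x ∈ N,
      R.X i (R.coset l x) - R.coset l (R.X i x) ∈ R.filt N l) ∧
    (∀ i, i ≤ n → posIdx n l ≤ i → ∀ x ∈ N,
      R.X (i + 1) (R.coset l x) - R.coset l (R.X i x) ∈ R.filt N l) ∧
    (∃ b : F, b ≠ 0 ∧ ∀ x ∈ N,
      R.X (posIdx n l) (R.coset l x) - b • R.coset l x ∈ R.filt N l)) ∧
    (∀ i, 1 ≤ i → i ≤ n + 1 → ∀ u ∈ R.filt N l, R.X i u ∈ R.filt N l) := by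
  induction l with
  | zero =>
    refine ⟨fun _ => ⟨fun i _ _ x _ => ?_, fun i hi hi' x _ => ?_, ⟨a, ha, fun x hx => ?_⟩⟩,
      fun i _ _ u hu => ?_⟩
    · simp [coset_zero]
    · simp only [posIdx, Nat.zero_le, if_true] at hi'
      omega
    · simp [coset_zero, posIdx, hN.X_last x hx]
    · have : u = 0 := hu
      rw [this, map_zero]
      exact Submodule.zero_mem _
  | succ l ih =>
    obtain ⟨h1, h4⟩ := ih (by omega)
    obtain ⟨h1, h2, b, hb, h3⟩ := h1 (by omega)
    have hposl : 1 ≤ posIdx n l ∧ posIdx n l ≤ n + 1 := by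
      unfold posIdx; split_ifs <;> omega
    have h5 : ∀ i, 1 ≤ i → i ≤ n + 1 → ∀ u ∈ R.filt N (l + 1), R.X i u ∈ R.filt N (l + 1) := by
      intro i hi hi'
      refine (sup_le (fun u hu => ?_) ?_ : R.filt N (l + 1) ≤ (R.filt N (l + 1)).comap (R.X i))
      · exact R.filt_mono (Nat.le_succ l) (h4 i hi hi' u hu)
      rintro _ ⟨x, hx, rfl⟩
      have key (y : M) (hy : y ∈ N) (h : R.X i (R.coset l x) - R.coset l y ∈ R.filt N l) :
          R.X i (R.coset l x) ∈ R.filt N (l + 1) := by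
        have := Submodule.add_mem _ (R.filt_mono (Nat.le_succ l) h) (R.coset_mem_filt (l := l) hy)
        rwa [sub_add_cancel] at this
      rcases lt_trichotomy i (posIdx n l) with h | h | h
      · exact key _ (hN.X_mem i (by omega) x hx) (h1 i hi h x hx)
      · subst h
        exact key (b • x) (N.smul_mem _ hx) (by rw [map_smul]; exact h3 x hx)
      · obtain ⟨j, rfl⟩ : ∃ j, i = j + 1 := ⟨i - 1, by omega⟩
        exact key _ (hN.X_mem j (by omega) x hx) (h2 j (by omega) (by omega) x hx)
    have hT {s : ℕ} (hs : s ≤ n) {u : M} (hu : u ∈ R.filt N l) : R.T s u ∈ R.filt N (l + 1) :=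
      R.T_mem_filt_succ hN (by omega) hs hu
    have hfar {s i : ℕ} (hs : s ≤ n) (hi : i ≤ n + 1) (h : i ≠ s) (h' : i ≠ s + 1) (x v : M)
        (hv : R.X i (R.coset l x) - v ∈ R.filt N l) :
        R.X i (R.T s (R.coset l x)) - R.T s v ∈ R.filt N (l + 1) := by
      rw [R.T_X_apply hs hi h h', ← map_sub]
      exact hT hs hv
    have hup {s : ℕ} (hs : 1 ≤ s) (hs' : s ≤ n) (x v : M) (hx : x ∈ N)
        (hv : R.X s (R.coset l x) - v ∈ R.filt N l) :
        R.X (s + 1) (R.T s (R.coset l x)) - R.T s v ∈ R.filt N (l + 1) := by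
      rw [R.X_succ_T hs hs', add_sub_right_comm, ← map_sub]
      exact Submodule.add_mem _ (hT hs' hv)
        (Submodule.smul_mem _ _ (h5 _ (by omega) (by omega) _ (R.coset_mem_filt hx)))
    have hdown {s : ℕ} (hs : 1 ≤ s) (hs' : s ≤ n) (x v : M) (hx : x ∈ N)
        (hv : R.X (s + 1) (R.coset l x) - v ∈ R.filt N l) :
        R.X s (R.T s (R.coset l x)) - R.T s v ∈ R.filt N (l + 1) := by
      rw [R.X_T hs hs', sub_right_comm, ← map_sub]
      exact Submodule.sub_mem _ (hT hs' hv)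
        (Submodule.smul_mem _ _ (h5 _ (by omega) (by omega) _ (R.coset_mem_filt hx)))
    refine ⟨fun hl => ?_, h5⟩
    rcases lt_trichotomy l n with hln | rfl | hln
    · have e1 : letterIdx n l = n - l := by simp [letterIdx, hln.le]
      have e2 : posIdx n l = n - l + 1 := by simp only [posIdx, hln.le, if_true]; omega
      have e3 : posIdx n (l + 1) = n - l := by
        simp only [posIdx, Nat.succ_le_of_lt hln, if_true]; omega
      simp only [coset_succ, e1, e3]
      rw [e2] at h1 h2 h3
      refine ⟨fun i hi hi' x hx => ?_, fun i hi hi' x hx => ?_, ⟨b, hb, fun x hx => ?_⟩⟩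
      · exact hfar (by omega) (by omega) (by omega) (by omega) _ _ (h1 i hi (by omega) x hx)
      · rcases Nat.eq_or_lt_of_le hi' with rfl | hi'
        · exact hup (by omega) (by omega) x _ hx (h1 _ (by omega) (by omega) x hx)
        · exact hfar (by omega) (by omega) (by omega) (by omega) _ _ (h2 i hi (by omega) x hx)
      · rw [← map_smul]
        exact hdown (by omega) (by omega) x _ hx (h3 x hx)
    · have e1 : letterIdx l l = 0 := by simp [letterIdx]
      have e2 : posIdx l l = 1 := by simp [posIdx]
      have e3 : posIdx l (l + 1) = 1 := by simp [posIdx]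
      simp only [coset_succ, e1, e3]
      rw [e2] at h1 h2 h3
      refine ⟨fun i hi hi' x hx => by omega, fun i hi hi' x hx => ?_,
        ⟨b⁻¹, inv_ne_zero hb, fun x hx => ?_⟩⟩
      · exact hfar (by omega) (by omega) (by omega) (by omega) _ _ (h2 i hi (by omega) x hx)
      · have hXi : ∀ u ∈ R.filt N l, R.Xi 1 u ∈ R.filt N l := by
          exact fun u hu => R.Xi_mem (by omega) (h4 1 le_rfl (by omega)) hu
        rw [R.X_one_T_zero, add_sub_right_comm, ← map_smul, ← map_sub]
        refine Submodule.add_mem _ (hT (by omega) ?_) (Submodule.smul_mem _ _ (Submodule.add_mem _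
          (h5 _ (by omega) (by omega) _ (R.coset_mem_filt hx)) (R.coset_mem_filt hx)))
        -- For `w = R.coset l x`, applying `X_1⁻¹` to `-b⁻¹ (X_1 w - b w)` gives `X_1⁻¹ w - b⁻¹ w`.
        have := hXi _ (Submodule.smul_mem _ (-b⁻¹) (h3 x hx))
        rw [map_smul, map_sub, R.Xi_X_apply (by omega), map_smul, smul_sub, smul_smul, neg_mul,
          inv_mul_cancel₀ hb, neg_smul, neg_smul, one_smul, sub_neg_eq_add] at this
        rwa [sub_eq_neg_add]
    · have e1 : letterIdx n l = l - n := by simp [letterIdx, hln]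
      have e2 : posIdx n l = l - n := by simp [posIdx, hln]
      have e3 : posIdx n (l + 1) = l - n + 1 := by
        rw [posIdx, if_neg (by omega)]; omega
      simp only [coset_succ, e1, e3]
      rw [e2] at h1 h2 h3
      refine ⟨fun i hi hi' x hx => ?_, fun i hi hi' x hx => ?_, ⟨b, hb, fun x hx => ?_⟩⟩
      · rcases Nat.eq_or_lt_of_le (Nat.le_of_lt_succ hi') with rfl | hi'
        · exact hdown (by omega) (by omega) x _ hx (h2 _ (by omega) (by omega) x hx)
        · exact hfar (by omega) (by omega) (by omega) (by omega) _ _ (h1 i hi (by omega) x hx)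
      · exact hfar (by omega) (by omega) (by omega) (by omega) _ _ (h2 i hi (by omega) x hx)
      · rw [← map_smul]
        exact hup (by omega) (by omega) x _ hx (h3 x hx)

/-- `X_0` commutes with every `T_i`, `i ≥ 1`, and crossing `T_0` turns it into `X_0 X_1`. So it
needs its own induction, run after the stability under `X_1` is known. -/
lemma X_mem_filt (hN : R.IsBase a N) (ha : a ≠ 0) [FiniteDimensional F N] {l i : ℕ}
    (hl : l ≤ 2 * n + 2) (hi : i ≤ n + 1) {u : M} (hu : u ∈ R.filt N l) :
    R.X i u ∈ R.filt N l := by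
  have hpos (l : ℕ) (hl : l ≤ 2 * n + 2) {i : ℕ} (hi : 1 ≤ i) (hi' : i ≤ n + 1) {u : M}
      (hu : u ∈ R.filt N l) : R.X i u ∈ R.filt N l :=
    (R.X_coset_aux hN ha l hl).2 i hi hi' u hu
  rcases Nat.eq_zero_or_pos i with rfl | hi0
  swap
  · exact hpos l hl hi0 hi hu
  suffices h : R.filt N l ≤ (R.filt N l).comap (R.X 0) from h hu
  clear hu u
  induction l with
  | zero => exact bot_le
  | succ l ih =>
    refine sup_le ((ih (by omega)).trans (Submodule.comap_mono (R.filt_mono (Nat.le_succ l)))) ?_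
    rintro _ ⟨x, hx, rfl⟩
    change R.X 0 (R.coset l x) ∈ R.filt N (l + 1)
    rcases l with _ | l
    · exact R.coset_mem_filt (l := 0) (hN.X_mem 0 (Nat.zero_le n) x hx)
    have hl' : letterIdx n l ≤ n := by unfold letterIdx; split_ifs <;> omega
    have hx' := R.coset_mem_filt (l := l) hx
    have ih' : ∀ u ∈ R.filt N (l + 1), R.X 0 u ∈ R.filt N (l + 1) := ih (by omega)
    rw [coset_succ]
    rcases Nat.eq_zero_or_pos (letterIdx n l) with h0 | h0
    · have h1 := ih' _ (hpos (l + 1) (by omega) le_rfl (by omega) hx')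
      rw [h0, R.X_zero_T]
      exact Submodule.sub_mem _ (R.T_mem_filt_succ hN (by omega) (Nat.zero_le n) h1)
        (Submodule.smul_mem _ _ (R.filt_mono (Nat.le_succ _) h1))
    · rw [R.T_X_apply hl' (Nat.zero_le _) (by omega) (by omega)]
      exact R.T_mem_filt_succ hN (by omega) hl' (ih' _ hx')

lemma filt_eq_top (hN : R.IsBase a N) (ha : a ≠ 0) [FiniteDimensional F N]
    (hgen : ∀ S : Submodule F M, N ≤ S → (∀ i ≤ n, ∀ u ∈ S, R.T i u ∈ S) →
      (∀ i ≤ n + 1, ∀ u ∈ S, R.X i u ∈ S) → (∀ i ≤ n + 1, ∀ u ∈ S, R.Xi i u ∈ S) → S = ⊤) :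
    R.filt N (2 * n + 2) = ⊤ := by
  have hX : ∀ i ≤ n + 1, ∀ u ∈ R.filt N (2 * n + 2), R.X i u ∈ R.filt N (2 * n + 2) :=
    fun i hi u hu => R.X_mem_filt hN ha le_rfl hi hu
  refine hgen _ (fun x hx => ?_) (fun i hi u hu => R.T_mem_filt_last hN hi hu) hX
    (fun i hi u hu => R.Xi_mem hi (hX i hi) hu)
  exact R.filt_mono (by omega : 1 ≤ 2 * n + 2) (R.coset_mem_filt (l := 0) hx)

/-- `X_i` passes through the `l`-th coset representative modulo the previous ones. -/
lemma X_coset (hN : R.IsBase a N) (ha : a ≠ 0) [FiniteDimensional F N] {l i : ℕ}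
    (hl : l ≤ 2 * n + 1) (hi : 1 ≤ i) (hi' : i ≤ n) {x : M} (hx : x ∈ N) :
    R.X (if i < posIdx n l then i else i + 1) (R.coset l x) - R.coset l (R.X i x)
      ∈ R.filt N l := by
  obtain ⟨h1, h2, -⟩ := (R.X_coset_aux hN ha l (by omega)).1 hl
  split_ifs with h
  · exact h1 i hi h x hx
  · exact h2 i hi' (not_lt.1 h) x hx

end HeckeOps

/-! ### Generalized eigenspaces and the upper bound -/

namespace HeckeOps

variable {F M : Type*} [Field F] [AddCommGroup M] [Module F M] {n : ℕ} {c₀ c : F}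
  (R : HeckeOps F M n c₀ c) {N : Submodule F M} {a : F}

/-- The common generalized eigenspace of `X_b, …, X_t` for the eigenvalue `a`. -/
def gen (a : F) (b t : ℕ) : Submodule F M :=
  ⨅ i ∈ Finset.Icc b t, (R.X i).maxGenEigenspace a

lemma mem_gen {b t : ℕ} {u : M} : u ∈ R.gen a b t ↔
    ∀ i, b ≤ i → i ≤ t → ∃ k : ℕ, ((R.X i - a • 1) ^ k) u = 0 := by
  simp [gen, Module.End.mem_maxGenEigenspace]

lemma commute_X_sub {i j : ℕ} (hi : i ≤ n + 1) (hj : j ≤ n + 1) :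
    Commute (R.X i - a • 1) (R.X j - a • 1) := by
  have h : Commute (R.X i) (R.X j) := R.X_X i hi j hj
  have h1 (f : Module.End F M) : Commute f (a • 1) := (Commute.one_right f).smul_right a
  exact (h.sub_right (h1 _)).sub_left ((h1 _).symm)

/-- On the `l`-th layer, `X_1, …, X_n` of `N` become the `X_j` with `j ≠ posIdx n l`, in order. So
the leading part of a generalized eigenvector comes from `N`, and nilpotent lifting makes it a true
generalized eigenvector there. `hbb'` ensures that the indices `b', …, n` are shifted to indices `≥
b`. -/
lemma exists_gen_coset (hN : R.IsBase a N) (ha : a ≠ 0) [FiniteDimensional F M] {l b b' : ℕ}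
    (hl : l ≤ 2 * n + 1) (hb' : 1 ≤ b')
    (hbb' : ∀ i, b' ≤ i → i ≤ n → b ≤ if i < posIdx n l then i else i + 1) {u : M}
    (hu : u ∈ R.gen a b (n + 1)) (hul : u ∈ R.filt N (l + 1)) :
    ∃ z ∈ N ⊓ R.gen a b' n, u - R.coset l z ∈ R.filt N l := by
  obtain ⟨v, hv, _, ⟨x, hx, rfl⟩, rfl⟩ := Submodule.mem_sup.1 hul
  -- The vectors of `N` that do not contribute to the `l`-th layer.
  let I : Submodule F M := N ⊓ (R.filt N l).comap (R.coset l)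
  have hsub {S : Submodule F M} {i : ℕ} (hS : ∀ y ∈ S, R.X i y ∈ S) :
      ∀ y ∈ S, (R.X i - a • 1) y ∈ S := fun y hy => S.sub_mem (hS y hy) (S.smul_mem a hy)
  have hpow {S : Submodule F M} {i : ℕ} (hS : ∀ y ∈ S, R.X i y ∈ S) (k : ℕ) :
      ∀ y ∈ S, ((R.X i - a • 1) ^ k) y ∈ S := by
    induction k with
    | zero => simp
    | succ k ih => intro y hy; rw [pow_succ', Module.End.mul_apply]; exact hsub hS _ (ih y hy)
  have hle (i : ℕ) (hi' : i ≤ n) : (if i < posIdx n l then i else i + 1) ≤ n + 1 := by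
    split_ifs <;> omega
  have hfilt {i : ℕ} (hi : i ≤ n) : ∀ y ∈ R.filt N l,
      R.X (if i < posIdx n l then i else i + 1) y ∈ R.filt N l := fun y hy =>
    R.X_mem_filt hN ha (by omega) (hle i hi) hy
  have hcong {i : ℕ} (hi : 1 ≤ i) (hi' : i ≤ n) (k : ℕ) :
      ((R.X (if i < posIdx n l then i else i + 1) - a • 1) ^ k) (R.coset l x) -
        R.coset l (((R.X i - a • 1) ^ k) x) ∈ R.filt N l := by
    induction k with
    | zero => simp
    | succ k ih =>
      have hxk := hpow (hN.X_mem i hi') k x hx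
      have h1 := hsub (hfilt hi') _ ih
      have h2 := R.X_coset hN ha hl hi hi' hxk
      have h3 := Submodule.add_mem _ h1 h2
      rw [pow_succ', pow_succ', Module.End.mul_apply, Module.End.mul_apply]
      convert h3 using 1
      simp only [LinearMap.sub_apply, map_sub, LinearMap.smul_apply, Module.End.one_apply, map_smul]
      abel
  obtain ⟨z, hz, hz', hxz⟩ := exists_nilpotent_lift_finset (Finset.Icc b' n)
    (fun i => R.X i - a • 1) N I (fun i hi j hj => R.commute_X_sub
      (by rw [Finset.mem_Icc] at hi; omega) (by rw [Finset.mem_Icc] at hj; omega))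
    (fun i hi => hsub (hN.X_mem i (Finset.mem_Icc.1 hi).2))
    (fun i hi => hsub fun y hy => ⟨hN.X_mem i (Finset.mem_Icc.1 hi).2 y hy.1, by
      rw [Finset.mem_Icc] at hi
      have h1 := R.X_coset hN ha hl (by omega) hi.2 hy.1
      have h2 := hfilt hi.2 _ hy.2
      have := Submodule.sub_mem _ h2 h1
      rwa [sub_sub_cancel] at this⟩) hx (fun i hi => by
      rw [Finset.mem_Icc] at hi
      obtain ⟨k, hk⟩ := R.mem_gen.1 hu _ (hbb' i hi.1 hi.2) (hle i hi.2)
      refine ⟨k, hpow (hN.X_mem i hi.2) k x hx, ?_⟩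
      have h1 := hcong (by omega) hi.2 k
      have h2 := hpow (hfilt hi.2) k v hv
      rw [map_add] at hk
      have h3 := Submodule.neg_mem _ (Submodule.add_mem _ h1 h2)
      rwa [sub_add_eq_add_sub, add_comm _ (_ : M), hk, zero_sub, neg_neg] at h3)
  refine ⟨z, ⟨hz, R.mem_gen.2 fun i hi hi' => hz' i (Finset.mem_Icc.2 ⟨hi, hi'⟩)⟩, ?_⟩
  rw [add_sub_assoc, ← map_sub]
  exact Submodule.add_mem _ hv hxz.2

/-- If the generalized eigenspace of `X_{n-m}, …, X_n` on `N` vanishes, that of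
`X_{n+1-m}, …, X_{n+1}` on the induced module is at most `2 (m + 1)` times larger than
that of `X_{n+1-m}, …, X_n` on `N`. -/
lemma finrank_gen_le (hN : R.IsBase a N) (ha : a ≠ 0) [FiniteDimensional F M]
    (htop : R.filt N (2 * n + 2) = ⊤) {m : ℕ} (hm : m ≤ n)
    (hmax : m = n ∨ N ⊓ R.gen a (n - m) n = ⊥) :
    Module.finrank F (R.gen a (n + 1 - m) (n + 1)) ≤
      2 * (m + 1) * Module.finrank F (N ⊓ R.gen a (n + 1 - m) n : Submodule F M) := by
  set d := Module.finrank F (N ⊓ R.gen a (n + 1 - m) n : Submodule F M) with hd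
  set D := R.gen a (n + 1 - m) (n + 1)
  -- The coefficient of `d` counts the `k < l` with `posIdx n k ≥ n + 1 - m`, namely `k ≤ m` and `k
  -- ≥ 2 * n + 1 - m`.
  have main (l : ℕ) (hl : l ≤ 2 * n + 2) :
      Module.finrank F (D ⊓ R.filt N l : Submodule F M) ≤
        (min l (m + 1) + (l - (2 * n + 1 - m))) * d := by
    induction l with
    | zero =>
      have : (D ⊓ R.filt N 0 : Submodule F M) = ⊥ := inf_bot_eq _
      rw [this, finrank_bot]
      exact Nat.zero_le _
    | succ l ih =>
      have ih := ih (by omega)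
      by_cases hfull : n + 1 - m ≤ posIdx n l
      · have h1 : D ⊓ R.filt N (l + 1) ≤
            R.filt N l ⊔ (N ⊓ R.gen a (n + 1 - m) n).map (R.coset l) := by
          rintro u ⟨hu, hul⟩
          obtain ⟨z, hz, huz⟩ := R.exists_gen_coset hN ha (b' := n + 1 - m) (by omega) (by omega)
            (fun i hi hi' => by split_ifs <;> omega) hu hul
          rw [← sub_add_cancel u (R.coset l z)]
          exact Submodule.add_mem_sup huz (Submodule.mem_map_of_mem hz)
        have h2 := finrank_le_of_le_sup h1
        have h3 : Module.finrank F ((D ⊓ R.filt N (l + 1)) ⊓ R.filt N l : Submodule F M) ≤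
            Module.finrank F (D ⊓ R.filt N l : Submodule F M) :=
          Submodule.finrank_mono (inf_le_inf_right _ inf_le_left)
        have h4 := Submodule.finrank_map_le (R.coset l) (N ⊓ R.gen a (n + 1 - m) n)
        have h5 : min l (m + 1) + (l - (2 * n + 1 - m)) + 1 ≤
            min (l + 1) (m + 1) + (l + 1 - (2 * n + 1 - m)) := by
          unfold posIdx at hfull
          split_ifs at hfull <;> omega
        calc _ ≤ (min l (m + 1) + (l - (2 * n + 1 - m))) * d + d := by omega
          _ = (min l (m + 1) + (l - (2 * n + 1 - m)) + 1) * d := by ring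
          _ ≤ _ := Nat.mul_le_mul_right d h5
      -- The skipped position lies below `n + 1 - m`, so all of `X_{n+1-m}, …, X_{n+1}` come from
      -- `X_{n-m}, …, X_n` on `N`, where `hmax` leaves no generalized eigenvector.
      · have hpos : 1 ≤ posIdx n l := by unfold posIdx; split_ifs <;> omega
        have hbot : N ⊓ R.gen a (n - m) n = ⊥ := hmax.resolve_left (by omega)
        have h1 : D ⊓ R.filt N (l + 1) ≤ D ⊓ R.filt N l := by
          rintro u ⟨hu, hul⟩
          obtain ⟨z, hz, huz⟩ := R.exists_gen_coset hN ha (b' := n - m) (by omega) (by omega)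
            (fun i hi hi' => by split_ifs <;> omega) hu hul
          rw [hbot, Submodule.mem_bot] at hz
          rw [hz, map_zero, sub_zero] at huz
          exact ⟨hu, huz⟩
        exact (Submodule.finrank_mono h1).trans (ih.trans (Nat.mul_le_mul_right d (by omega)))
  have h := main (2 * n + 2) le_rfl
  rw [htop, inf_top_eq] at h
  refine h.trans (Nat.mul_le_mul_right d ?_)
  omega

/-- Generalized eigenspaces for a constant string of eigenvalues are stable under the `T_i`
that permute this string. -/
lemma T_mem_gen {b t i : ℕ} (hb : 1 ≤ b) (ht : t ≤ n + 1) (hi : b ≤ i) (hi' : i + 1 ≤ t) {u : M}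
    (hu : u ∈ R.gen a b t) : R.T i u ∈ R.gen a b t := by
  -- Each `y'` either passes `G` and becomes `y`, or replaces `G` by `Q`, which commutes with `y'`.
  -- The first can happen fewer than `k` times; after the second, `y' ^ l` kills the vector.
  have aux (y y' G Q : Module.End F M) (hyG : ∀ v, y' (Q v) = Q (y' v))
      (h : ∀ v, y' (G v) = G (y v) + Q v) (k l : ℕ) : ∀ v, (y ^ k) v = 0 → (y' ^ l) v = 0 →
      (∀ w, y (y' w) = y' (y w)) → (y' ^ (k + l)) (G v) = 0 := by
    induction k with
    | zero => intro v hv _ _; simp only [pow_zero, Module.End.one_apply] at hv; simp [hv]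
    | succ k ih =>
      intro v hv hv' hc
      have hQ (j : ℕ) (w : M) : (y' ^ j) (Q w) = Q ((y' ^ j) w) := by
        induction j with
        | zero => rfl
        | succ j ih => simp only [pow_succ', Module.End.mul_apply, ih, hyG]
      have hc' : Commute y y' := LinearMap.ext hc
      rw [Nat.add_right_comm, pow_succ, Module.End.mul_apply, h, map_add, ih (y v) ?_ ?_ hc, hQ,
        pow_add, Module.End.mul_apply, hv', map_zero, map_zero, zero_add]
      · rwa [pow_succ, Module.End.mul_apply] at hv
      · rw [← Module.End.mul_apply, ← (hc'.pow_right l).eq, Module.End.mul_apply, hv', map_zero]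
  have hcomm {j k : ℕ} (hj : j ≤ n + 1) (hk : k ≤ n + 1) (v : M) :
      (R.X j - a • 1) ((R.X k - a • 1) v) = (R.X k - a • 1) ((R.X j - a • 1) v) :=
    LinearMap.congr_fun (R.commute_X_sub hj hk) v
  have hcomm' {j k : ℕ} (hj : j ≤ n + 1) (hk : k ≤ n + 1) (d : F) (v : M) :
      (R.X j - a • 1) ((d • R.X k) v) = (d • R.X k) ((R.X j - a • 1) v) := by
    simp only [LinearMap.sub_apply, LinearMap.smul_apply, Module.End.one_apply, map_smul, map_sub,
      R.X_X_apply hj hk, smul_sub, smul_comm a d]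
  rw [mem_gen] at hu ⊢
  intro j hj hj'
  obtain ⟨k, hk⟩ := hu i hi (by omega)
  obtain ⟨l, hl⟩ := hu (i + 1) (by omega) hi'
  by_cases h1 : j = i
  · subst h1
    refine ⟨l + k, aux (R.X (j + 1) - a • 1) (R.X j - a • 1) (R.T j) (-c • R.X (j + 1))
      (hcomm' (by omega) (by omega) _) (fun v => ?_) l k u hl hk (hcomm (by omega) (by omega))⟩
    simp only [LinearMap.sub_apply, LinearMap.smul_apply, Module.End.one_apply, map_smul, map_sub,
      R.X_T (by omega : 1 ≤ j) (by omega)]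
    module
  by_cases h2 : j = i + 1
  · subst h2
    refine ⟨k + l, aux (R.X i - a • 1) (R.X (i + 1) - a • 1) (R.T i) (c • R.X (i + 1))
      (hcomm' (by omega) (by omega) _) (fun v => ?_) k l u hk hl (hcomm (by omega) (by omega))⟩
    simp only [LinearMap.sub_apply, LinearMap.smul_apply, Module.End.one_apply, map_smul, map_sub,
      R.X_succ_T (by omega : 1 ≤ i) (by omega)]
    module
  · obtain ⟨r, hr⟩ := hu j hj hj'
    have h3 : Commute (R.T i) (R.X j - a • 1) :=
      (show Commute (R.T i) (R.X j) from R.T_X_comm i (by omega) j (by omega) h1 h2).sub_right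
        ((Commute.one_right _).smul_right a)
    refine ⟨r, ?_⟩
    rw [← Module.End.mul_apply, ← (h3.pow_right r).eq, Module.End.mul_apply, hr, map_zero]

lemma X_mem_gen {b t i : ℕ} (ht : t ≤ n + 1) (hi : i ≤ n + 1) {u : M}
    (hu : u ∈ R.gen a b t) : R.X i u ∈ R.gen a b t := by
  rw [mem_gen] at hu ⊢
  intro j hj hj'
  obtain ⟨r, hr⟩ := hu j hj hj'
  have h3 : Commute (R.X i) (R.X j - a • 1) :=
    (show Commute (R.X i) (R.X j) from R.X_X i hi j (by omega)).sub_right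
      ((Commute.one_right _).smul_right a)
  refine ⟨r, ?_⟩
  rw [← Module.End.mul_apply, ← (h3.pow_right r).eq, Module.End.mul_apply, hr, map_zero]

end HeckeOps

/-! ### Independent translates and the lower bound -/

namespace HeckeOps

variable {F M : Type*} [Field F] [AddCommGroup M] [Module F M] {n : ℕ} {c₀ c : F}
  (R : HeckeOps F M n c₀ c) {N : Submodule F M} {a : F}

/-- The product `T_j T_{j+1} ⋯ T_{t-1}`. -/
def run (j : ℕ) : ℕ → Module.End F M
  | 0 => 1
  | t + 1 => if j ≤ t then run j t * R.T t else 1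

lemma run_self (j : ℕ) (u : M) : R.run j j u = u := by
  cases j with
  | zero => rfl
  | succ j => simp [run]

lemma run_succ {j t : ℕ} (h : j ≤ t) (u : M) : R.run j (t + 1) u = R.run j t (R.T t u) := by
  simp [run, h]

lemma run_mem {E : Submodule F M} {b t j : ℕ} (hj : b ≤ j) (hjt : j ≤ t)
    (hE : ∀ i, b ≤ i → i < t → ∀ u ∈ E, R.T i u ∈ E) {u : M} (hu : u ∈ E) :
    R.run j t u ∈ E := by
  induction t, hjt using Nat.le_induction generalizing u with
  | base => rwa [run_self]
  | succ t hjt ih =>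
    rw [R.run_succ hjt]
    exact ih (fun i hi hi' => hE i hi (by omega)) (hE t (by omega) (by omega) u hu)

lemma X_run {j t i : ℕ} (hj : j ≤ t) (hi : t < i) (hi' : i ≤ n + 1) (u : M) :
    R.X i (R.run j t u) = R.run j t (R.X i u) := by
  induction t, hj using Nat.le_induction generalizing u with
  | base => rw [run_self, run_self]
  | succ t hjt ih =>
    rw [R.run_succ hjt, R.run_succ hjt, ih (by omega),
      R.T_X_apply (by omega) hi' (by omega) (by omega)]

/-- If `X_t` acts as a scalar on `E` and the other `X_i` are unipotent up to that scalar, then the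
subspaces `T_j ⋯ T_{t-1} E` are independent. -/
lemma run_independent (hc : c ≠ 0) (ha : a ≠ 0) {b t : ℕ} (hb : 1 ≤ b) (hbt : b ≤ t) :
    ∀ E : Submodule F M, t ≤ n + 1 → (∀ u ∈ E, R.X t u = a • u) →
    (∀ i, b ≤ i → i + 1 < t → ∀ u ∈ E, R.T i u ∈ E) →
    (∀ i, b ≤ i → i < t → ∀ u ∈ E, R.X i u ∈ E) → E ≤ R.gen a b t →
    ∀ e : ℕ → M, (∀ j, e j ∈ E) → ∑ j ∈ Finset.Ico b (t + 1), R.run j t (e j) = 0 →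
    ∀ j ∈ Finset.Ico b (t + 1), e j = 0 := by
  induction t, hbt using Nat.le_induction with
  | base =>
    intro E _ _ _ _ _ e _ h j hj
    rw [Nat.Ico_succ_singleton, Finset.sum_singleton, run_self] at h
    rw [Nat.Ico_succ_singleton, Finset.mem_singleton] at hj
    rw [hj, h]
  | succ t hbt ih =>
    intro E ht hXt hT hX hgen
    have hsplit (e : ℕ → M) : ∑ j ∈ Finset.Ico b (t + 1 + 1), R.run j (t + 1) (e j) =
        ∑ j ∈ Finset.Ico b (t + 1), R.run j t (R.T t (e j)) + e (t + 1) := by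
      rw [Finset.sum_Ico_succ_top (by omega), run_self]
      congr 1
      refine Finset.sum_congr rfl fun j hj => ?_
      rw [R.run_succ (by rw [Finset.mem_Ico] at hj; omega)]
    -- The inner induction is on the nilpotency order of `X_t - a` on the coefficients below the top
    -- one.
    have key (k : ℕ) : ∀ e : ℕ → M, (∀ j, e j ∈ E) →
        (∀ j ∈ Finset.Ico b (t + 1), ((R.X t - a • 1) ^ k) (e j) = 0) →
        ∑ j ∈ Finset.Ico b (t + 1 + 1), R.run j (t + 1) (e j) = 0 →
        ∀ j ∈ Finset.Ico b (t + 1 + 1), e j = 0 := by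
      induction k with
      | zero =>
        intro e _ h0 h j hj
        simp only [pow_zero, Module.End.one_apply] at h0
        rw [hsplit, Finset.sum_eq_zero fun j hj => by rw [h0 j hj, map_zero, map_zero],
          zero_add] at h
        rw [Finset.mem_Ico] at hj
        rcases Nat.eq_or_lt_of_le (Nat.le_of_lt_succ hj.2) with rfl | hj'
        · exact h
        · exact h0 j (Finset.mem_Ico.2 ⟨hj.1, hj'⟩)
      | succ k ihk =>
        intro e he h0 h
        -- Applying `X_{t+1} - a` to the relation gives a relation of the same form. By `X_{t+1} T_t
        -- = T_t X_t + c X_{t+1}`, it replaces `e j` by `(X_t - a) (e j)` and collects the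
        -- corrections in the top coefficient, which stays in `E`.
        let e' : ℕ → M := fun j => if j = t + 1 then
          (c * a) • ∑ j ∈ Finset.Ico b (t + 1), R.run j t (e j) else (R.X t - a • 1) (e j)
        have he'1 : e' (t + 1) = (c * a) • ∑ j ∈ Finset.Ico b (t + 1), R.run j t (e j) := by
          simp [e']
        have he'2 : ∀ j ∈ Finset.Ico b (t + 1), e' j = (R.X t - a • 1) (e j) := by
          intro j hj
          rw [Finset.mem_Ico] at hj
          simp only [e', if_neg (by omega : j ≠ t + 1)]
        have he' : ∀ j, e' j ∈ E := by
          intro j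
          simp only [e']
          split_ifs
          · refine E.smul_mem _ (Submodule.sum_mem _ fun j hj => ?_)
            rw [Finset.mem_Ico] at hj
            exact R.run_mem hj.1 (by omega) (fun i hi hi' => hT i hi (by omega)) (he j)
          · exact E.sub_mem (hX t hbt (by omega) _ (he j)) (E.smul_mem a (he j))
        have hrel := congrArg (R.X (t + 1) - a • 1 : Module.End F M) h
        have hterm : ∀ j ∈ Finset.Ico b (t + 1), (R.X (t + 1) - a • 1 : Module.End F M)
            (R.run j t (R.T t (e j))) =
            R.run j t (R.T t (e' j)) + (c * a) • R.run j t (e j) := by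
          intro j hj
          rw [he'2 j hj]
          rw [Finset.mem_Ico] at hj
          simp only [LinearMap.sub_apply, LinearMap.smul_apply, Module.End.one_apply, map_sub,
            map_smul]
          rw [R.X_run (by omega) (by omega) ht, R.X_succ_T (by omega) (by omega), hXt _ (he j)]
          simp only [map_add, map_smul]
          module
        rw [hsplit, map_add, map_sum, map_zero, Finset.sum_congr rfl hterm,
          Finset.sum_add_distrib, ← Finset.smul_sum, ← he'1] at hrel
        have hlast : (R.X (t + 1) - a • 1 : Module.End F M) (e (t + 1)) = 0 := by
          simp [hXt _ (he _)]
        rw [hlast, add_zero, ← hsplit] at hrel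
        have hzero := ihk e' he' (fun j hj => by
          rw [he'2 j hj, ← Module.End.mul_apply, ← pow_succ]
          exact h0 j hj) hrel
        have hy : ∀ j ∈ Finset.Ico b (t + 1), (R.X t - a • 1 : Module.End F M) (e j) = 0 :=
          fun j hj => by
            rw [← he'2 j hj]
            rw [Finset.mem_Ico] at hj
            exact hzero j (Finset.mem_Ico.2 ⟨hj.1, by omega⟩)
        have hs := hzero (t + 1) (Finset.mem_Ico.2 ⟨by omega, by omega⟩)
        rw [he'1, smul_eq_zero, or_iff_right (mul_ne_zero hc ha)] at hs
        -- As `e' = 0`, the `e j` with `j ≤ t` lie in this smaller space and satisfy the relation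
        -- for `t`, so the outer induction applies.
        let E' : Submodule F M := E ⊓ LinearMap.ker (R.X t - a • 1 : Module.End F M)
        have hE' {u : M} : u ∈ E' ↔ u ∈ E ∧ R.X t u = a • u := by
          simp [E', sub_eq_zero]
        let f : ℕ → M := fun j => if j ∈ Finset.Ico b (t + 1) then e j else 0
        have hf : ∀ j ∈ Finset.Ico b (t + 1), f j = e j := fun j hj => if_pos hj
        have hsmall := ih E' (by omega) (fun u hu => (hE'.1 hu).2)
          (fun i hi hi' u hu => by
            rw [hE'] at hu ⊢
            refine ⟨hT i hi (by omega) u hu.1, ?_⟩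
            rw [R.T_X_apply (by omega) (by omega) (by omega) (by omega), hu.2, map_smul])
          (fun i hi hi' u hu => by
            rw [hE'] at hu ⊢
            refine ⟨hX i hi (by omega) u hu.1, ?_⟩
            rw [R.X_X_apply (by omega) (by omega), hu.2, map_smul])
          (fun u hu => by
            have := R.mem_gen.1 (hgen (hE'.1 hu).1)
            exact R.mem_gen.2 fun i hi hi' => this i hi (by omega)) f
          (fun j => by
            simp only [f]
            split_ifs with hj
            · rw [hE']
              have := hy j hj
              refine ⟨he j, ?_⟩
              simpa [sub_eq_zero] using this
            · exact E'.zero_mem)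
          (by rw [← hs]; exact Finset.sum_congr rfl fun j hj => by rw [hf j hj])
        have hej : ∀ j ∈ Finset.Ico b (t + 1), e j = 0 := fun j hj => by
          rw [← hf j hj]; exact hsmall j hj
        rw [hsplit, Finset.sum_eq_zero fun j hj => by rw [hej j hj, map_zero, map_zero],
          zero_add] at h
        intro j hj
        rw [Finset.mem_Ico] at hj
        rcases Nat.eq_or_lt_of_le (Nat.le_of_lt_succ hj.2) with rfl | hj'
        · exact h
        · exact hej j (Finset.mem_Ico.2 ⟨hj.1, hj'⟩)
    intro e he
    choose K hK using fun j => R.mem_gen.1 (hgen (he j)) t hbt (by omega)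
    refine key ((Finset.Ico b (t + 1)).sup K) e he fun j hj => ?_
    rw [← Nat.sub_add_cancel (Finset.le_sup hj : K j ≤ _), pow_add, Module.End.mul_apply, hK,
      map_zero]

/-- The generalized eigenspace of `X_b, …, X_n` on the eigenspace of `X_{n+1}`. -/
def eigenGen (a : F) (b : ℕ) : Submodule F M :=
  (R.X (n + 1)).eigenspace a ⊓ R.gen a b n

lemma mem_eigenGen {b : ℕ} {u : M} :
    u ∈ R.eigenGen a b ↔ R.X (n + 1) u = a • u ∧ u ∈ R.gen a b n := by
  simp [eigenGen]

lemma eigenGen_le_gen (b : ℕ) : R.eigenGen a b ≤ R.gen a b (n + 1) := by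
  intro u hu
  rw [mem_eigenGen] at hu
  refine R.mem_gen.2 fun i hi hi' => ?_
  rcases Nat.eq_or_lt_of_le hi' with rfl | hi'
  · exact ⟨1, by simp [hu.1]⟩
  · exact R.mem_gen.1 hu.2 i hi (by omega)

/-- By independence, the `n + 2 - b` translates of `eigenGen` form a direct sum of copies of it
inside `gen`. -/
lemma mul_finrank_eigenGen_le (hc : c ≠ 0) (ha : a ≠ 0) [FiniteDimensional F M] {b : ℕ}
    (hb : 1 ≤ b) (hbn : b ≤ n + 1) :
    (n + 2 - b) * Module.finrank F (R.eigenGen a b) ≤ Module.finrank F (R.gen a b (n + 1)) := by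
  let Φ : (Finset.Ico b (n + 2) → R.eigenGen a b) →ₗ[F] M :=
    ∑ j, R.run j.1 (n + 1) ∘ₗ (R.eigenGen a b).subtype ∘ₗ LinearMap.proj j
  have hΦ (e : Finset.Ico b (n + 2) → R.eigenGen a b) :
      Φ e = ∑ j, R.run j.1 (n + 1) (e j) := by
    simp [Φ]
  have hmem (e) : Φ e ∈ R.gen a b (n + 1) := by
    rw [hΦ]
    refine Submodule.sum_mem _ fun j _ => ?_
    have hj := Finset.mem_Ico.1 j.2
    exact R.run_mem hj.1 (by omega)
      (fun i hi hi' u hu => R.T_mem_gen hb le_rfl hi (by omega) hu) (R.eigenGen_le_gen b (e j).2)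
  have hinj : Function.Injective (Φ.codRestrict _ hmem) := by
    rw [← LinearMap.ker_eq_bot, LinearMap.ker_codRestrict, LinearMap.ker_eq_bot']
    intro e he
    let f : ℕ → M := fun j => if hj : j ∈ Finset.Ico b (n + 2) then e ⟨j, hj⟩ else 0
    have hf (j : Finset.Ico b (n + 2)) : f j = e j := by simp only [f, j.2, dif_pos]
    have := R.run_independent hc ha hb hbn (R.eigenGen a b) le_rfl
      (fun u hu => (R.mem_eigenGen.1 hu).1)
      (fun i hi hi' u hu => by
        rw [mem_eigenGen] at hu ⊢
        refine ⟨?_, R.T_mem_gen hb (by omega) hi (by omega) hu.2⟩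
        rw [R.T_X_apply (by omega) le_rfl (by omega) (by omega), hu.1, map_smul])
      (fun i hi hi' u hu => by
        rw [mem_eigenGen] at hu ⊢
        refine ⟨?_, R.X_mem_gen (by omega) (by omega) hu.2⟩
        rw [R.X_X_apply le_rfl (by omega), hu.1, map_smul])
      (R.eigenGen_le_gen b) f (fun j => by
        simp only [f]
        split_ifs
        · exact Subtype.prop _
        · exact Submodule.zero_mem _)
      (by rw [← he, hΦ, ← Finset.sum_coe_sort]
          exact Finset.sum_congr rfl fun j _ => by rw [hf])
    funext j
    apply Subtype.ext
    rw [← hf]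
    exact this j j.2
  have := LinearMap.finrank_le_finrank_of_injective hinj
  rwa [Module.finrank_pi_fintype, Finset.sum_const, Finset.card_univ, Fintype.card_coe,
    Nat.card_Ico, smul_eq_mul] at this

/-- There is a stable subspace of an eigenspace of `X_{n+1}` whose intersection with `N` is nonzero
and has at least half its dimension. -/
lemma exists_finrank_eigenGen_le (hN : R.IsBase a N) (hc : c ≠ 0) (ha : a ≠ 0)
    [FiniteDimensional F M] (htop : R.filt N (2 * n + 2) = ⊤) (hne : N ≠ ⊥) :
    ∃ b, N ⊓ R.eigenGen a b ≠ ⊥ ∧ Module.finrank F (R.eigenGen a b) ≤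
      2 * Module.finrank F (N ⊓ R.eigenGen a b : Submodule F M) := by
  classical
  -- For `k = 0` the range of indices is empty and there is no condition. The greatest `k` gives the
  -- longest string `X_{n+1-k}, …, X_n` with a common generalized eigenvector in `N`.
  let P : ℕ → Prop := fun k => N ⊓ R.gen a (n + 1 - k) n ≠ ⊥
  have hP0 : P 0 := by
    have : R.gen a (n + 1 - 0) n = ⊤ := by simp [gen]
    simp only [P, this, inf_top_eq]
    exact hne
  set m := Nat.findGreatest P n with hm
  have hmn : m ≤ n := Nat.findGreatest_le n
  have hPm : P m := Nat.findGreatest_spec (Nat.zero_le n) hP0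
  have hmax : m = n ∨ N ⊓ R.gen a (n - m) n = ⊥ := by
    rcases Nat.eq_or_lt_of_le hmn with h | h
    · exact Or.inl h
    · right
      have := Nat.findGreatest_is_greatest (P := P) (Nat.lt_succ_self m) (Nat.succ_le_of_lt h)
      rw [not_not, Nat.succ_eq_add_one, Nat.add_sub_add_right] at this
      exact this
  have hV : N ⊓ R.eigenGen a (n + 1 - m) = N ⊓ R.gen a (n + 1 - m) n := by
    ext u
    simp only [Submodule.mem_inf, mem_eigenGen]
    exact ⟨fun h => ⟨h.1, h.2.2⟩, fun h => ⟨h.1, hN.X_last u h.1, h.2⟩⟩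
  refine ⟨n + 1 - m, by rw [hV]; exact hPm, ?_⟩
  have h1 := R.mul_finrank_eigenGen_le hc ha (b := n + 1 - m) (by omega) (by omega)
  have h2 := R.finrank_gen_le hN ha htop hmn hmax
  rw [(by omega : n + 2 - (n + 1 - m) = m + 1)] at h1
  rw [hV]
  refine Nat.le_of_mul_le_mul_left (h1.trans (h2.trans_eq ?_)) (Nat.succ_pos m)
  ring

end HeckeOps

/-! ### Equivariant maps out of a simple module -/

section Equivariant

variable {F A N M : Type*} [Field F] [Ring A] [Algebra F A] [AddCommGroup N] [Module F N]
  [Module A N] [IsSimpleModule A N] [AddCommGroup M] [Module F M]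

/-- An equivariant map from a simple module that sends a nonzero vector to a stable subspace takes
all its values there. -/
lemma equivariant_mem_of_mem (θ : A →ₐ[F] Module.End F M) {f : N →ₗ[F] M}
    (hf : ∀ h x, f (h • x) = θ h (f x)) {S : Submodule F M} (hS : ∀ h, ∀ u ∈ S, θ h u ∈ S)
    {x : N} (hx : x ≠ 0) (hfx : f x ∈ S) (y : N) : f y ∈ S := by
  let K : Submodule A N :=
    { carrier := {z | f z ∈ S}
      add_mem' := fun {u v} hu hv => by
        change f (u + v) ∈ S; rw [map_add]; exact S.add_mem hu hv
      zero_mem' := by change f 0 ∈ S; rw [map_zero]; exact S.zero_mem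
      smul_mem' := fun h z hz => by change f (h • z) ∈ S; rw [hf]; exact hS h _ hz }
  rcases eq_bot_or_eq_top K with h | h
  · exact absurd ((Submodule.mem_bot A).1 (h ▸ hfx : x ∈ (⊥ : Submodule A N))) hx
  · exact (h ▸ Submodule.mem_top : y ∈ K)

lemma equivariant_injective (θ : A →ₐ[F] Module.End F M) {f : N →ₗ[F] M}
    (hf : ∀ h x, f (h • x) = θ h (f x)) (hne : f ≠ 0) : Function.Injective f := by
  rw [injective_iff_map_eq_zero]
  intro x hx
  by_contra h
  refine hne (LinearMap.ext fun y => ?_)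
  have := equivariant_mem_of_mem θ hf (S := ⊥) (by simp) h (by simpa using hx) y
  simpa using this

/-- If the equivariant maps `f` send `ι⁻¹ E` to `E` and `ι N ∩ E ≠ 0` has at least half the
dimension of `E`, then the space of equivariant maps has dimension at most two. -/
lemma exists_le_span_pair [IsAlgClosed F] [FiniteDimensional F N] [FiniteDimensional F M]
    (θ : A →ₐ[F] Module.End F M)
    (K : Submodule F (N →ₗ[F] M)) (hK : ∀ f ∈ K, ∀ h x, f (h • x) = θ h (f x))
    {ι : N →ₗ[F] M} (hι : ι ∈ K) (hι0 : ι ≠ 0) (E : Submodule F M)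
    (hE : ∀ f ∈ K, ∀ x, ι x ∈ E → f x ∈ E) (hne : LinearMap.range ι ⊓ E ≠ ⊥)
    (hdim : Module.finrank F E ≤
      2 * Module.finrank F (LinearMap.range ι ⊓ E : Submodule F M)) :
    ∃ g, K ≤ Submodule.span F {ι, g} := by
  have hinj := equivariant_injective θ (hK ι hι) hι0
  have hstable : ∀ h, ∀ u ∈ LinearMap.range ι, θ h u ∈ LinearMap.range ι := by
    rintro h _ ⟨x, rfl⟩
    exact ⟨h • x, hK ι hι h x⟩
  let V : Submodule F N := E.comap ι
  have hmap : V.map ι = LinearMap.range ι ⊓ E := Submodule.map_comap_eq ι E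
  have hVdim : Module.finrank F V =
      Module.finrank F (LinearMap.range ι ⊓ E : Submodule F M) := by
    rw [← hmap]
    exact (LinearEquiv.finrank_eq (Submodule.equivMapOfInjective ι hinj V))
  have hVne : V ≠ ⊥ := fun h => hne (by rw [← hmap, h, Submodule.map_bot])
  have : Nontrivial V := Submodule.nontrivial_iff_ne_bot.2 hVne
  have hzero : ∀ f ∈ K, ∀ x, x ≠ 0 → f x = 0 → f = 0 := by
    intro f hf x hx hfx
    by_contra h
    exact hx (equivariant_injective θ (hK f hf) h (by rw [hfx, map_zero]))
  -- Schur's lemma: subtracting an eigenvalue of `ι⁻¹ f` produces an equivariant map that kills a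
  -- nonzero vector.
  have hscalar : ∀ f ∈ K, (∀ x, f x ∈ LinearMap.range ι) → ∃ d : F, f = d • ι := by
    intro f hf hfr
    let e := LinearEquiv.ofInjective ι hinj
    let φ : Module.End F N := e.symm.toLinearMap ∘ₗ f.codRestrict _ hfr
    have hφ (x : N) : ι (φ x) = f x := by
      have : e (φ x) = ⟨f x, hfr x⟩ := e.apply_symm_apply _
      exact congrArg Subtype.val this
    have : Nontrivial N := IsSimpleModule.nontrivial A N
    obtain ⟨d, hd⟩ := Module.End.exists_eigenvalue φ
    obtain ⟨x, hx⟩ := hd.exists_hasEigenvector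
    refine ⟨d, sub_eq_zero.1 (hzero _ (K.sub_mem hf (K.smul_mem d hι)) x hx.2 ?_)⟩
    rw [LinearMap.sub_apply, LinearMap.smul_apply, ← hφ, hx.apply_eq_smul, map_smul, sub_self]
  by_cases hall : ∀ f ∈ K, ∀ x, f x ∈ LinearMap.range ι
  · refine ⟨0, fun f hf => ?_⟩
    obtain ⟨d, rfl⟩ := hscalar f hf (hall f hf)
    exact Submodule.smul_mem _ _ (Submodule.subset_span (by simp))
  push Not at hall
  obtain ⟨g, hg, z, hz⟩ := hall
  refine ⟨g, fun f hf => ?_⟩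
  let W : Submodule F E := (LinearMap.range ι).comap E.subtype
  have hW : Module.finrank F W = Module.finrank F V := by
    rw [hVdim, inf_comm, ← Submodule.map_comap_subtype, Submodule.finrank_map_subtype_eq]
  let toQ (f : N →ₗ[F] M) (hf : f ∈ K) : V →ₗ[F] E ⧸ W :=
    W.mkQ ∘ₗ f.restrict (fun x hx => hE f hf x hx)
  have htoQ (f : N →ₗ[F] M) (hf : f ∈ K) (x : V) : toQ f hf x = 0 ↔ f x ∈ LinearMap.range ι := by
    simp only [toQ, LinearMap.comp_apply, Submodule.mkQ_apply, Submodule.Quotient.mk_eq_zero]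
    rfl
  -- A nonzero kernel vector would be sent by `g` into the range of `ι`, forcing all of `g` into it.
  have hginj : Function.Injective (toQ g hg) := by
    rw [injective_iff_map_eq_zero]
    intro x hx
    rw [htoQ g hg] at hx
    by_contra h
    exact hz (equivariant_mem_of_mem θ (hK g hg) hstable (fun h' => h (Subtype.ext h')) hx z)
  have hrank : Module.finrank F (E ⧸ W) = Module.finrank F V := by
    have h1 := Submodule.finrank_quotient_add_finrank W
    have h2 := LinearMap.finrank_le_finrank_of_injective hginj
    omega
  -- An eigenvector of `g⁻¹ f` on `V` is a vector on which `f` and `d • g` agree modulo the range of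
  -- `ι`.
  let e := LinearEquiv.ofInjectiveOfFinrankEq (toQ g hg) hginj hrank.symm
  obtain ⟨d, hd⟩ := Module.End.exists_eigenvalue
    (e.symm.toLinearMap ∘ₗ toQ f hf : Module.End F V)
  obtain ⟨x, hx⟩ := hd.exists_hasEigenvector
  have hx1 : toQ f hf x = d • toQ g hg x := by
    have := congrArg e hx.apply_eq_smul
    rw [LinearMap.comp_apply, map_smul] at this
    exact (e.apply_symm_apply _).symm.trans this
  have hfg : f - d • g ∈ K := K.sub_mem hf (K.smul_mem d hg)
  have hx2 : toQ (f - d • g) hfg x = 0 := by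
    have : toQ (f - d • g) hfg x = toQ f hf x - d • toQ g hg x := rfl
    rw [this, hx1, sub_self]
  obtain ⟨d', hd'⟩ := hscalar _ hfg (equivariant_mem_of_mem θ (hK _ hfg) hstable
    (fun h => hx.2 (Subtype.ext h)) ((htoQ _ hfg x).1 hx2))
  rw [Submodule.mem_span_pair]
  exact ⟨d', d, by rw [← hd', sub_add_cancel]⟩

end Equivariant

/-! ### From Hecke modules to systems of operators -/

namespace HeckeB

variable {F : Type*} [Field F] {p q : Fˣ} {n : ℕ}

lemma laurentEval_T_one {A : Type*} [Ring A] [Algebra F A] (u : Aˣ) :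
    laurentEval (F := F) u (LaurentPolynomial.T 1) = u := by
  change AddMonoidAlgebra.lift F A ℤ _ (AddMonoidAlgebra.single 1 1) = _
  rw [AddMonoidAlgebra.lift_single]
  simp

lemma mul_self_of_quadratic {A : Type*} [Ring A] [Algebra F A] {t : A} {r : Fˣ}
    (h : (t - algebraMap F A r) * (t + algebraMap F A ((r⁻¹ : Fˣ) : F)) = 0) :
    t * t = ((r : F) - (r : F)⁻¹) • t + 1 := by
  simp only [Algebra.algebraMap_eq_smul_one, sub_mul, mul_add, smul_mul_assoc, mul_smul_comm,
    one_mul, mul_one, Units.val_inv_eq_inv_val, smul_sub, smul_smul, inv_mul_cancel₀ r.ne_zero,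
    one_smul] at h
  rw [← sub_eq_zero, ← h]
  module

lemma T_mul_self_zero (i : Fin n) (hi : i.val = 0) :
    T p q n i * T p q n i = ((p : F) - (p : F)⁻¹) • T p q n i + 1 := by
  have h := mk_rel p q n (Rel.quad_zero i hi)
  simp only [map_mul, map_sub, map_add, map_zero, AlgHom.commutes] at h
  exact mul_self_of_quadratic h

lemma T_mul_self (i : Fin n) (hi : 1 ≤ i.val) :
    T p q n i * T p q n i = ((q : F) - (q : F)⁻¹) • T p q n i + 1 := by
  have h := mk_rel p q n (Rel.quad i hi)
  simp only [map_mul, map_sub, map_add, map_zero, AlgHom.commutes] at h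
  exact mul_self_of_quadratic h

/-- The operators by which the generators of `H_{n+1}` act in a representation. -/
noncomputable def ops {M : Type*} [AddCommGroup M] [Module F M]
    (θ : Hecke F p q (n + 1) →ₐ[F] Module.End F M) :
    HeckeOps F M n ((p : F) - (p : F)⁻¹) ((q : F) - (q : F)⁻¹) where
  T i := if h : i < n + 1 then θ (T p q (n + 1) ⟨i, h⟩) else 0
  X j := if h : j < n + 2 then θ (X p q (n + 1) ⟨j, h⟩ : (Hecke F p q (n + 1))ˣ) else 0
  Xi j := if h : j < n + 2 then θ ((X p q (n + 1) ⟨j, h⟩)⁻¹ : (Hecke F p q (n + 1))ˣ) else 0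
  X_Xi j hj := by
    rw [dif_pos (by omega), dif_pos (by omega), ← map_mul, Units.mul_inv, map_one]
  Xi_X j hj := by
    rw [dif_pos (by omega), dif_pos (by omega), ← map_mul, Units.inv_mul, map_one]
  X_X j hj k hk := by
    rw [dif_pos (by omega), dif_pos (by omega), ← map_mul, ← map_mul]
    have h := mk_rel p q (n + 1) (Rel.X_X ⟨j, by omega⟩ ⟨k, by omega⟩)
    simp only [map_mul] at h
    exact congrArg θ h
  quad_zero := by
    rw [dif_pos (by omega), ← map_mul, T_mul_self_zero _ rfl, map_add, map_smul, map_one]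
  quad i hi hi' := by
    rw [dif_pos (by omega), ← map_mul, T_mul_self _ hi, map_add, map_smul, map_one]
  braid i hi hi' := by
    rw [dif_pos (by omega), dif_pos (by omega)]
    simp only [← map_mul]
    have h := mk_rel p q (n + 1) (Rel.braid ⟨i, by omega⟩ ⟨i + 1, by omega⟩ hi rfl)
    simp only [map_mul] at h
    exact congrArg θ h
  T_T i k hik hk := by
    rw [dif_pos (by omega), dif_pos (by omega)]
    simp only [← map_mul]
    have h := mk_rel p q (n + 1) (Rel.T_T ⟨i, by omega⟩ ⟨k, by omega⟩ hik)
    simp only [map_mul] at h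
    exact congrArg θ h
  braid_zero hn := by
    rw [dif_pos (by omega), dif_pos (by omega)]
    simp only [← map_mul]
    have h := mk_rel p q (n + 1) (Rel.braid_zero ⟨0, by omega⟩ ⟨1, by omega⟩ rfl rfl)
    simp only [map_mul] at h
    exact congrArg θ h
  T_X_zero := by
    rw [dif_pos (by omega), dif_pos (by omega), dif_pos (by omega)]
    simp only [← map_mul]
    have h := mk_rel p q (n + 1) (Rel.T_X_zero ⟨0, by omega⟩ rfl)
    simp only [map_mul] at h
    exact congrArg θ h
  T_X_comm i hi j hj hij hij' := by
    rw [dif_pos (by omega), dif_pos (by omega)]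
    simp only [← map_mul]
    have h := mk_rel p q (n + 1) (Rel.T_X_comm ⟨i, by omega⟩ ⟨j, by omega⟩
        (fun e => hij (congrArg Fin.val e)) (fun e => hij' (congrArg Fin.val e)))
    simp only [map_mul] at h
    exact congrArg θ h
  T_X i hi hi' := by
    rw [dif_pos (by omega), dif_pos (by omega), dif_pos (by omega)]
    simp only [← map_mul]
    have h := mk_rel p q (n + 1) (Rel.T_X ⟨i, by omega⟩ hi)
    simp only [map_mul] at h
    exact congrArg θ h

section

variable {M : Type*} [AddCommGroup M] [Module F M]
    (θ : Hecke F p q (n + 1) →ₐ[F] Module.End F M)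

lemma ops_T {i : ℕ} (h : i < n + 1) : (ops θ).T i = θ (T p q (n + 1) ⟨i, h⟩) := dif_pos h

lemma ops_X {j : ℕ} (h : j < n + 2) :
    (ops θ).X j = θ (X p q (n + 1) ⟨j, h⟩ : (Hecke F p q (n + 1))ˣ) := dif_pos h

lemma ops_Xi {j : ℕ} (h : j < n + 2) :
    (ops θ).Xi j = θ ((X p q (n + 1) ⟨j, h⟩)⁻¹ : (Hecke F p q (n + 1))ˣ) := dif_pos h

lemma incl_T (i : Fin n) : incl p q n (T p q n i) = T p q (n + 1) i.castSucc := by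
  rw [T, incl_mk, FreeAlgebra.lift_ι_apply]
  rfl

lemma incl_X (j : Fin (n + 1)) : incl p q n (X p q n j : (Hecke F p q n)ˣ) =
    (X p q (n + 1) j.castSucc : (Hecke F p q (n + 1))ˣ) := by
  change incl p q n (mk p q n (freeX F n j)) = _
  rw [incl_mk, FreeAlgebra.lift_ι_apply]
  rfl

lemma mem_of_ops_mem {S : Submodule F M} (hT : ∀ i ≤ n, ∀ u ∈ S, (ops θ).T i u ∈ S)
    (hX : ∀ i ≤ n + 1, ∀ u ∈ S, (ops θ).X i u ∈ S)
    (hXi : ∀ i ≤ n + 1, ∀ u ∈ S, (ops θ).Xi i u ∈ S) (h : Hecke F p q (n + 1)) :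
    ∀ u ∈ S, θ h u ∈ S := by
  obtain ⟨x, rfl⟩ : ∃ y, mk p q (n + 1) y = h := RingQuot.mkAlgHom_surjective F _ h
  induction x using FreeAlgebra.induction with
  | grade0 r =>
    intro u hu
    rw [AlgHom.commutes, AlgHom.commutes, Module.algebraMap_end_apply]
    exact S.smul_mem r hu
  | grade1 g =>
    intro u hu
    cases g with
    | T i =>
      have h := hT i (by omega) u hu
      rw [ops_T θ i.2] at h
      exact h
    | X j =>
      have h := hX j (by omega) u hu
      rw [ops_X θ j.2] at h
      exact h
    | Xinv j =>
      have h := hXi j (by omega) u hu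
      rw [ops_Xi θ j.2] at h
      exact h
  | mul a b ha hb =>
    intro u hu
    rw [map_mul, map_mul, Module.End.mul_apply]
    exact ha _ (hb u hu)
  | add a b ha hb =>
    intro u hu
    rw [map_add, map_add, LinearMap.add_apply]
    exact S.add_mem (ha u hu) (hb u hu)

end

section Induced

variable (p q n) (a : Fˣ) (N : Type*) [AddCommGroup N] [Module F N]
  [Module (Hecke F p q n) N] [IsScalarTower F (Hecke F p q n) N]

/-- The action of `H_{n+1}` on `f_a N`. -/
noncomputable abbrev fIndAction : Hecke F p q (n + 1) →ₐ[F] Module.End F (fInd p q n a N) :=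
  Algebra.lsmul F F (fInd p q n a N)

/-- The canonical map `N → f_a N`. -/
noncomputable def toFInd : N →ₗ[F] fInd p q n a N :=
  ((indRel (parabolicIncl p q n)
    (outer (Algebra.lsmul F F N : Hecke F p q n →ₐ[F] _) (oneDim a))).mkQ.restrictScalars F) ∘ₗ
    TensorProduct.mk F _ _ 1 ∘ₗ (TensorProduct.mk F N F).flip 1

variable {N}

lemma toFInd_apply (x : N) :
    toFInd p q n a N x = Submodule.Quotient.mk (1 ⊗ₜ[F] (x ⊗ₜ[F] (1 : F))) := rfl

lemma parabolicIncl_smul_toFInd (h : Hecke F p q n) (f : F[T;T⁻¹]) (x : N) :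
    parabolicIncl p q n (h ⊗ₜ f) • toFInd p q n a N x =
      Submodule.Quotient.mk (1 ⊗ₜ[F] ((h • x) ⊗ₜ[F] (oneDim a f 1))) := by
  rw [toFInd_apply, ← Submodule.Quotient.mk_smul, TensorProduct.smul_tmul', smul_eq_mul, mul_one]
  refine (Submodule.Quotient.eq _).2 (Submodule.subset_span ⟨1, h ⊗ₜ f, x ⊗ₜ 1, ?_⟩)
  rw [one_mul]
  rfl

lemma incl_smul_toFInd (h : Hecke F p q n) (x : N) :
    incl p q n h • toFInd p q n a N x = toFInd p q n a N (h • x) := by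
  have := parabolicIncl_smul_toFInd p q n a h 1 x
  rw [map_one (oneDim a), Module.End.one_apply] at this
  rw [toFInd_apply p q n a (h • x), ← this]
  simp [parabolicIncl]

lemma X_last_smul_toFInd (x : N) :
    ((X p q (n + 1) (Fin.last (n + 1)) : (Hecke F p q (n + 1))ˣ) : Hecke F p q (n + 1)) •
      toFInd p q n a N x = (a : F) • toFInd p q n a N x := by
  have := parabolicIncl_smul_toFInd p q n a 1 (LaurentPolynomial.T 1) x
  have h3 : parabolicIncl p q n (1 ⊗ₜ LaurentPolynomial.T 1) =
      (X p q (n + 1) (Fin.last (n + 1)) : (Hecke F p q (n + 1))ˣ) := by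
    simp [parabolicIncl, laurentEval_T_one]
  rw [h3] at this
  rw [this, one_smul, toFInd_apply]
  have h2 : oneDim a (LaurentPolynomial.T 1) (1 : F) = (a : F) • (1 : F) := by
    rw [oneDim, AlgHom.comp_apply, laurentEval_T_one]
    rfl
  rw [h2, TensorProduct.tmul_smul, TensorProduct.tmul_smul]
  rfl

lemma eq_top_of_smul_mem {S : Submodule F (fInd p q n a N)}
    (hS : ∀ (h : Hecke F p q (n + 1)), ∀ u ∈ S, h • u ∈ S)
    (hN : LinearMap.range (toFInd p q n a N) ≤ S) : S = ⊤ := by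
  rw [eq_top_iff]
  rintro u -
  obtain ⟨z, rfl⟩ := Submodule.Quotient.mk_surjective _ u
  induction z using TensorProduct.induction_on with
  | zero => exact S.zero_mem
  | add y z hy hz => exact S.add_mem hy hz
  | tmul b v =>
    induction v using TensorProduct.induction_on with
    | zero => rw [TensorProduct.tmul_zero]; exact S.zero_mem
    | add y z hy hz => rw [TensorProduct.tmul_add]; exact S.add_mem hy hz
    | tmul x r =>
      have h1 := hS b _ (hN ⟨r • x, rfl⟩)
      rw [toFInd_apply, TensorProduct.smul_tmul, smul_eq_mul, mul_one,
        ← Submodule.Quotient.mk_smul, TensorProduct.smul_tmul', smul_eq_mul, mul_one] at h1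
      exact h1

end Induced

end HeckeB

/-! ### Restriction to `N` and the bound -/

namespace HeckeB

section Bound

variable {F : Type*} [Field F] (p q : Fˣ) (n : ℕ) (a : Fˣ) (N : Type*) [AddCommGroup N]
  [Module F N] [Module (Hecke F p q n) N] [IsScalarTower F (Hecke F p q n) N]

/-- The maps `N ⊠ (a) → f_a N` of modules over the parabolic subalgebra. -/
def parabolicHom : Submodule F (N →ₗ[F] fInd p q n a N) where
  carrier := {f | (∀ (h : Hecke F p q n) x, f (h • x) = incl p q n h • f x) ∧
    ∀ x, ((X p q (n + 1) (Fin.last (n + 1)) : (Hecke F p q (n + 1))ˣ) : Hecke F p q (n + 1)) • f x =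
      (a : F) • f x}
  add_mem' := fun hf hg => ⟨fun h x => by simp [hf.1, hg.1], fun x => by simp [hf.2, hg.2]⟩
  zero_mem' := ⟨fun h x => by simp, fun x => by simp⟩
  smul_mem' := fun d f hf => ⟨fun h x => by
      rw [LinearMap.smul_apply, LinearMap.smul_apply, hf.1, smul_comm], fun x => by
      rw [LinearMap.smul_apply, smul_comm, hf.2, smul_comm]⟩

lemma toFInd_mem : toFInd p q n a N ∈ parabolicHom p q n a N :=
  ⟨fun h x => (incl_smul_toFInd p q n a h x).symm, fun x => X_last_smul_toFInd p q n a x⟩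

variable {p q n a N}

lemma ops_X_apply {f : N →ₗ[F] fInd p q n a N} (hf : f ∈ parabolicHom p q n a N) {i : ℕ}
    (hi : i < n + 1) (x : N) : (ops (fIndAction p q n a N)).X i (f x) =
      f (((X p q n ⟨i, hi⟩ : (Hecke F p q n)ˣ) : Hecke F p q n) • x) := by
  rw [hf.1, incl_X, ops_X _ (by omega)]
  rfl

lemma isBase_range : (ops (fIndAction p q n a N)).IsBase (a : F)
    (LinearMap.range (toFInd p q n a N)) where
  T_mem i hi := by
    rintro _ ⟨x, rfl⟩
    rw [ops_T _ (by omega)]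
    refine ⟨T p q n ⟨i, hi⟩ • x, ?_⟩
    rw [← incl_smul_toFInd, incl_T]
    rfl
  X_mem i hi := by
    rintro _ ⟨x, rfl⟩
    rw [ops_X_apply (toFInd_mem p q n a N) (by omega)]
    exact ⟨_, rfl⟩
  X_last := by
    rintro _ ⟨x, rfl⟩
    rw [ops_X _ (by omega)]
    exact (toFInd_mem p q n a N).2 x

/-- Membership is detected on `N`: the canonical map is injective, so `(X_i - a) ^ k` already kills
`x`, and `f` carries this over. -/
lemma mem_eigenGen_of_parabolicHom [IsSimpleModule (Hecke F p q n) N]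
    (h0 : toFInd p q n a N ≠ 0) {f : N →ₗ[F] fInd p q n a N} (hf : f ∈ parabolicHom p q n a N)
    {b : ℕ} {x : N} (hx : toFInd p q n a N x ∈ (ops (fIndAction p q n a N)).eigenGen (a : F) b) :
    f x ∈ (ops (fIndAction p q n a N)).eigenGen (a : F) b := by
  have hι := toFInd_mem p q n a N
  have hinj := equivariant_injective ((fIndAction p q n a N).comp (incl p q n)) hι.1 h0
  have hpow {g : N →ₗ[F] fInd p q n a N} (hg : g ∈ parabolicHom p q n a N) {i : ℕ}
      (hi : i < n + 1) (k : ℕ) :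
      (((ops (fIndAction p q n a N)).X i - (a : F) • 1) ^ k) (g x) =
        g (((Algebra.lsmul F F N ((X p q n ⟨i, hi⟩ : (Hecke F p q n)ˣ) : Hecke F p q n) -
          (a : F) • 1) ^ k) x) := by
    induction k with
    | zero => rfl
    | succ k ih =>
      rw [pow_succ', pow_succ', Module.End.mul_apply, ih, Module.End.mul_apply,
        LinearMap.sub_apply, ops_X_apply hg hi, LinearMap.sub_apply, map_sub]
      simp
  rw [HeckeOps.mem_eigenGen] at hx ⊢
  refine ⟨?_, ?_⟩
  · rw [ops_X _ (by omega)]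
    exact hf.2 x
  · rw [HeckeOps.mem_gen] at hx ⊢
    intro i hi hi'
    obtain ⟨k, hk⟩ := hx.2 i hi hi'
    refine ⟨k, ?_⟩
    rw [hpow hι (by omega), map_eq_zero_iff _ hinj] at hk
    rw [hpow hf (by omega), hk, map_zero]

lemma filt_range_eq_top [FiniteDimensional F N] :
    (ops (fIndAction p q n a N)).filt (LinearMap.range (toFInd p q n a N)) (2 * n + 2) = ⊤ :=
  (ops (fIndAction p q n a N)).filt_eq_top isBase_range a.ne_zero fun _ hS hT hX hXi =>
    eq_top_of_smul_mem p q n a (mem_of_ops_mem _ hT hX hXi) hS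

lemma finiteDimensional_fInd [FiniteDimensional F N] : FiniteDimensional F (fInd p q n a N) := by
  have := (ops (fIndAction p q n a N)).finiteDimensional_filt
    (N := LinearMap.range (toFInd p q n a N)) (2 * n + 2)
  rw [filt_range_eq_top] at this
  exact Module.Finite.equiv (Submodule.topEquiv (R := F) (M := fInd p q n a N))

lemma exists_parabolicHom_le_span_pair [IsAlgClosed F] [FiniteDimensional F N]
    [IsSimpleModule (Hecke F p q n) N] (hq : ¬ IsOfFinOrder q) (h0 : toFInd p q n a N ≠ 0) :
    ∃ g, parabolicHom p q n a N ≤ Submodule.span F {toFInd p q n a N, g} := by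
  have := finiteDimensional_fInd (p := p) (q := q) (n := n) (a := a) (N := N)
  -- `q = q⁻¹` would give `q ^ 2 = 1`.
  have hc : (q : F) - (q : F)⁻¹ ≠ 0 := by
    intro h
    refine hq (isOfFinOrder_iff_pow_eq_one.2 ⟨2, by norm_num, Units.ext ?_⟩)
    rw [sub_eq_zero, ← mul_eq_one_iff_eq_inv₀ q.ne_zero] at h
    rw [Units.val_pow_eq_pow_val, pow_two, h, Units.val_one]
  obtain ⟨b, hb, hdim⟩ := (ops (fIndAction p q n a N)).exists_finrank_eigenGen_le isBase_range hc
    a.ne_zero filt_range_eq_top (by rwa [ne_eq, LinearMap.range_eq_bot])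
  exact exists_le_span_pair ((fIndAction p q n a N).comp (incl p q n)) (parabolicHom p q n a N)
    (fun f hf => hf.1) (toFInd_mem p q n a N) h0 _
    (fun f hf x hx => mem_eigenGen_of_parabolicHom h0 hf hx) hb hdim

/-- Restriction along `N → f_a N`. -/
noncomputable def endToHom : Module.End (Hecke F p q (n + 1)) (fInd p q n a N) →ₗ[F]
    (N →ₗ[F] fInd p q n a N) where
  toFun φ := φ.restrictScalars F ∘ₗ toFInd p q n a N
  map_add' _ _ := rfl
  map_smul' _ _ := rfl

lemma endToHom_injective : Function.Injective (endToHom (p := p) (q := q) (n := n) (a := a)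
    (N := N)) := by
  intro φ ψ h
  have htop := eq_top_of_smul_mem p q n a
    (S := LinearMap.eqLocus (φ.restrictScalars F) (ψ.restrictScalars F))
    (fun h u hu => by
      change φ (h • u) = ψ (h • u)
      rw [map_smul, map_smul]
      exact congrArg (h • ·) hu)
    (by rintro _ ⟨x, rfl⟩; exact LinearMap.congr_fun h x)
  exact LinearMap.ext fun u => (htop ▸ Submodule.mem_top :
    u ∈ LinearMap.eqLocus (φ.restrictScalars F) (ψ.restrictScalars F))

lemma endToHom_mem (φ : Module.End (Hecke F p q (n + 1)) (fInd p q n a N)) :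
    endToHom φ ∈ parabolicHom p q n a N := by
  have hι := toFInd_mem p q n a N
  refine ⟨fun h x => ?_, fun x => ?_⟩
  · change φ (toFInd p q n a N (h • x)) = incl p q n h • φ (toFInd p q n a N x)
    rw [hι.1, map_smul]
  · change _ • φ (toFInd p q n a N x) = (a : F) • φ (toFInd p q n a N x)
    rw [← map_smul, hι.2]
    exact (φ.restrictScalars F).map_smul _ _

end Bound

end HeckeB

theorem mainTheorem8 {F : Type*} [Field F] [IsAlgClosed F] (hF : ringChar F ≠ 2)
    (p q : Fˣ) (hp : ¬ IsOfFinOrder p) (hq : ¬ IsOfFinOrder q)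
    (n : ℕ) (N : Type*) [AddCommGroup N] [Module F N] [Module (HeckeB.Hecke F p q n) N]
    [IsScalarTower F (HeckeB.Hecke F p q n) N] [FiniteDimensional F N]
    [IsSimpleModule (HeckeB.Hecke F p q n) N]
    (a : Fˣ) (ha : a = 1 ∨ a = -1) :
    Module.rank F
      (Module.End (HeckeB.Hecke F p q (n + 1)) (HeckeB.fInd p q n a N)) ≤ 2 := by
  classical
  have hspan : ∃ g, LinearMap.range (HeckeB.endToHom (p := p) (q := q) (n := n) (a := a) (N := N))
      ≤ Submodule.span F {HeckeB.toFInd p q n a N, g} := by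
    by_cases h0 : HeckeB.toFInd p q n a N = 0
    · refine ⟨0, ?_⟩
      rintro _ ⟨φ, rfl⟩
      have : HeckeB.endToHom φ = 0 := by
        change φ.restrictScalars F ∘ₗ HeckeB.toFInd p q n a N = 0
        rw [h0, LinearMap.comp_zero]
      rw [this]
      exact Submodule.zero_mem _
    · obtain ⟨g, hg⟩ := HeckeB.exists_parabolicHom_le_span_pair hq h0
      refine ⟨g, le_trans ?_ hg⟩
      rintro _ ⟨φ, rfl⟩
      exact HeckeB.endToHom_mem φ
  obtain ⟨g, hg⟩ := hspan
  rw [(LinearEquiv.ofInjective _ (HeckeB.endToHom_injective (p := p) (q := q) (n := n) (a := a)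
    (N := N))).rank_eq]
  refine (Submodule.rank_mono hg).trans ((rank_span_le _).trans ?_)
  refine (Cardinal.mk_insert_le).trans ?_
  rw [Cardinal.mk_singleton]
  exact one_add_one_eq_two.le
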